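/- Let $G$ be a (finite-dimensional, real, smooth) Lie group with Lie algebra $\mathfrak g=T_1G$, let $\pi$ be a Poisson tensor on $G$, that is, a smooth bivector field such that $\{f,h\}=\pi(df,dh)$ satisfies the Jacobi identity on $C^\infty(G)$, and suppose that $\pi$ is invariant under left translations. Assume that $\pi$ is unimodular, in the following sense: its value $r=\pi(1)\in\wedge^2\mathfrak g$, also regarded as the linear map $r:\mathfrak g^*\to\mathfrak g$ given by $\alpha(r(\beta))=r(\alpha,\beta)$, is a solution of the classical Yang–Baxter equation $$\alpha([r(\beta),r(\gamma)])+\beta([r(\gamma),r(\alpha)])+\gamma([r(\alpha),r(\beta)])=0\qquad(\alpha,\beta,\gamma\in\mathfrak g^*),$$ and the Lie subalgebra $\operatorname{Im} r\subset\mathfrak g$ is unimodular, i.e. for every $u\in\operatorname{Im}r$ the endomorphism $\mathrm{ad}_u:\operatorname{Im}r\to\operatorname{Im}r$, $v\mapsto[u,v]$, has trace $0$. Then, for every right-invariant Riemannian metric $g$ on $G$, $\pi$ is a Killing–Poisson tensor on $(G,g)$, which means: 1. the divergence of $\pi$ with respect to the Levi-Civita connection $\nabla$ of $g$, i.e. the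 vector field $\operatorname{div}\pi$ obtained by contracting $\nabla\pi$, given by $(\operatorname{div}\pi)(\beta)=\sum_i(\nabla_{e_i}\pi)(e^i,\beta)$ for any local frame $(e_i)$ with dual coframe $(e^i)$, vanishes; 2. for every open set $U\subset G$ and every $f\in C^\infty(U)$ that is a Casimir function of $\pi|_U$ (i.e. $\pi(df,\cdot)=0$ on $U$), one has $L_{\nabla f}\pi=0$ on $U$, where $\nabla f$ is the gradient vector field given by $g(\nabla f,Y)=df(Y)$. -/

import Mathlib

set_option maxSynthPendingDepth 3

open Bundle Manifold Module
open scoped ContDiff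

namespace KillingPoisson

/-! ### The classical Yang-Baxter equation -/

section YangBaxter

variable {𝔤 : Type*} [LieRing 𝔤] [LieAlgebra ℝ 𝔤]

/-- The linear map `r : 𝔤* → 𝔤` attached to a bilinear form `r` on `𝔤*` by
`α (r β) = r (α, β)` (see `apply_sharp`). -/
noncomputable def sharp [FiniteDimensional ℝ 𝔤] (r : Dual ℝ 𝔤 →ₗ[ℝ] Dual ℝ 𝔤 →ₗ[ℝ] ℝ) :
    Dual ℝ 𝔤 →ₗ[ℝ] 𝔤 :=
  (evalEquiv ℝ 𝔤).symm.toLinearMap ∘ₗ r.flip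

theorem apply_sharp [FiniteDimensional ℝ 𝔤] (r : Dual ℝ 𝔤 →ₗ[ℝ] Dual ℝ 𝔤 →ₗ[ℝ] ℝ)
    (α β : Dual ℝ 𝔤) : α (sharp r β) = r α β := by
  simp [sharp]

/-- `r` is a solution of the classical Yang-Baxter equation: `r` is an element of `Λ²𝔤`
(an alternating bilinear form on `𝔤*`) and
`[r, r](α, β, γ) = α([r β, r γ]) + β([r γ, r α]) + γ([r α, r β])` vanishes identically. -/
structure IsYangBaxterSolution [FiniteDimensional ℝ 𝔤]
    (r : Dual ℝ 𝔤 →ₗ[ℝ] Dual ℝ 𝔤 →ₗ[ℝ] ℝ) : Prop where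
  alternating : ∀ α, r α α = 0
  yangBaxter : ∀ α β γ : Dual ℝ 𝔤,
    α ⁅sharp r β, sharp r γ⁆ + β ⁅sharp r γ, sharp r α⁆ + γ ⁅sharp r α, sharp r β⁆ = 0

/-- The image `Im r` of a solution of the classical Yang-Baxter equation, as a Lie subalgebra. -/
noncomputable def imageSubalgebra [FiniteDimensional ℝ 𝔤]
    (r : Dual ℝ 𝔤 →ₗ[ℝ] Dual ℝ 𝔤 →ₗ[ℝ] ℝ) (hr : IsYangBaxterSolution r) : LieSubalgebra ℝ 𝔤 :=
  { LinearMap.range (sharp r) with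
    lie_mem' := by
      rintro _ _ ⟨β, rfl⟩ ⟨γ, rfl⟩
      show ⁅sharp r β, sharp r γ⁆ ∈ LinearMap.range (sharp r)
      have hskew : ∀ α β : Dual ℝ 𝔤, r α β = - r β α := by
        intro α β
        have h := hr.alternating (α + β)
        simp only [map_add, LinearMap.add_apply, hr.alternating, zero_add, add_zero] at h
        linarith
      by_contra hmem
      obtain ⟨α, hα, hker⟩ := Submodule.exists_le_ker_of_notMem hmem
      have hzero : sharp r α = 0 := by
        rw [← forall_dual_apply_eq_zero_iff ℝ]
        intro δ
        rw [apply_sharp, hskew, ← apply_sharp]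
        have := hker (LinearMap.mem_range_self (sharp r) δ)
        rw [LinearMap.mem_ker] at this
        rw [this, neg_zero]
      have h := hr.yangBaxter α β γ
      rw [hzero] at h
      simp at h
      exact hα h }

/-- A Lie algebra is unimodular if all its inner derivations `ad u` have trace zero. -/
def IsUnimodularLieAlgebra (𝔥 : Type*) [LieRing 𝔥] [LieAlgebra ℝ 𝔥] : Prop :=
  ∀ u : 𝔥, LinearMap.trace ℝ 𝔥 (LieAlgebra.ad ℝ 𝔥 u) = 0

/-- A unimodular solution of the classical Yang-Baxter equation: a solution `r` whose image
`Im r` is a unimodular Lie algebra. -/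
def IsUnimodularYangBaxterSolution [FiniteDimensional ℝ 𝔤]
    (r : Dual ℝ 𝔤 →ₗ[ℝ] Dual ℝ 𝔤 →ₗ[ℝ] ℝ) : Prop :=
  ∃ hr : IsYangBaxterSolution r, IsUnimodularLieAlgebra (imageSubalgebra r hr)

end YangBaxter

/-! ### Tensor fields on a manifold -/

section Manifold

variable {E : Type*} [NormedAddCommGroup E] [NormedSpace ℝ E] [FiniteDimensional ℝ E]
  {H : Type*} [TopologicalSpace H] (I : ModelWithCorners ℝ E H)
  {M : Type*} [TopologicalSpace M] [ChartedSpace H M]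

instance (x : M) : FiniteDimensional ℝ (TangentSpace I x) :=
  inferInstanceAs (FiniteDimensional ℝ E)

instance (x : M) : T2Space (TangentSpace I x) :=
  inferInstanceAs (T2Space E)

/-- The cotangent space `T*ₓM`. -/
abbrev CotangentSpace (x : M) : Type _ := TangentSpace I x →L[ℝ] ℝ

/-- Bilinear forms on `T*ₓM`, i.e. contravariant 2-tensors at `x`. -/
abbrev TwoTensor (x : M) : Type _ := CotangentSpace I x →L[ℝ] CotangentSpace I x →L[ℝ] ℝ

variable {I}

/-- The 1-form `α` is smooth near `x`. -/
def SmoothOneFormAt [IsManifold I ∞ M] (α : ∀ x : M, CotangentSpace I x) (x : M) : Prop :=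
  ContMDiffAt I (I.prod 𝓘(ℝ, E →L[ℝ] ℝ)) ∞
    (fun y ↦ Bundle.TotalSpace.mk' (E →L[ℝ] ℝ) y (α y)) x

/-- `P` is a smooth bivector field, i.e. a smooth section of `Λ²TM`. -/
structure IsBivectorField [IsManifold I ∞ M] (P : ∀ x : M, TwoTensor I x) : Prop where
  alternating : ∀ (x : M) (α : CotangentSpace I x), P x α α = 0
  smooth : ContMDiff I (I.prod 𝓘(ℝ, (E →L[ℝ] ℝ) →L[ℝ] (E →L[ℝ] ℝ) →L[ℝ] ℝ)) ∞
    (fun y ↦ Bundle.TotalSpace.mk' ((E →L[ℝ] ℝ) →L[ℝ] (E →L[ℝ] ℝ) →L[ℝ] ℝ) y (P y))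

/-- The bracket `{f, g} = P(df, dg)`. -/
noncomputable def poissonBracket (P : ∀ x : M, TwoTensor I x) (f g : M → ℝ) : M → ℝ :=
  fun x ↦ P x (mvfderiv I f x) (mvfderiv I g x)

/-- `P` is a Poisson tensor: a smooth bivector field whose bracket satisfies the Jacobi
identity on `C^∞(M)`. -/
structure IsPoissonTensor [IsManifold I ∞ M] (P : ∀ x : M, TwoTensor I x) : Prop
    extends IsBivectorField P where
  jacobi : ∀ f g h : M → ℝ, ContMDiff I 𝓘(ℝ) ∞ f → ContMDiff I 𝓘(ℝ) ∞ g → ContMDiff I 𝓘(ℝ) ∞ h →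
    ∀ x, poissonBracket P f (poissonBracket P g h) x + poissonBracket P g (poissonBracket P h f) x
      + poissonBracket P h (poissonBracket P f g) x = 0

/-- Let `D` be a derivation of vector fields at the point `x` in the direction `v`
(`D Y = ∇_v Y` for a connection `∇`, or `D Y = [X, Y]ₓ` with `v = X x`). This is the induced
derivative at `x` of a 1-form `α`, namely the covector `D α` given by
`(D α)(Y) = v.(α(Y)) - α(D Y)`.
As the right-hand side depends on the value of `Y` at `x` only, `D α` is written through its
values on a basis of the tangent space, extended to vector fields. -/
noncomputable def derivOneForm [IsManifold I ∞ M] (x : M) (v : TangentSpace I x)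
    (D : (∀ y : M, TangentSpace I y) → TangentSpace I x)
    (α : ∀ y : M, CotangentSpace I y) : CotangentSpace I x :=
  let e := finBasis ℝ (TangentSpace I x)
  ∑ j, (mvfderiv I (fun y ↦ α y (FiberBundle.extend E (e j) y)) x v
      - α x (D (FiberBundle.extend E (e j)))) • LinearMap.toContinuousLinearMap (e.coord j)

/-- With `D` and `v` as in `derivOneForm`, the induced derivative at `x` of a bivector field,
`(D P)(α, β) = v.(P(α, β)) - P(D α, β) - P(α, D β)`. -/
noncomputable def derivBivector [IsManifold I ∞ M] (x : M) (v : TangentSpace I x)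
    (D : (∀ y : M, TangentSpace I y) → TangentSpace I x)
    (P : ∀ y : M, TwoTensor I y) (α β : ∀ y : M, CotangentSpace I y) : ℝ :=
  mvfderiv I (fun y ↦ P y (α y) (β y)) x v
    - P x (derivOneForm x v D α) (β x) - P x (α x) (derivOneForm x v D β)

/-- The Lie derivative `(L_X P)(α, β)` at `x`. -/
noncomputable def lieDerivBivector [IsManifold I ∞ M] (X : ∀ y : M, TangentSpace I y)
    (P : ∀ y : M, TwoTensor I y) (α β : ∀ y : M, CotangentSpace I y) (x : M) : ℝ :=
  derivBivector x (X x) (fun Y ↦ VectorField.mlieBracket I X Y x) P α β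

/-- The covariant derivative `(∇_v P)(α, β)` at `x`. (In Mathlib `cov Y x v` is `∇_v Y`.) -/
noncomputable def covDerivBivector [IsManifold I ∞ M]
    (cov : CovariantDerivative I E (TangentSpace I : M → Type _))
    (P : ∀ y : M, TwoTensor I y) (α β : ∀ y : M, CotangentSpace I y) (x : M)
    (v : TangentSpace I x) : ℝ :=
  derivBivector x v (fun Y ↦ cov Y x v) P α β

/-- The divergence of a bivector field with respect to a connection, i.e. the vector field
`div P` obtained by contracting `∇P`, evaluated on a 1-form `β`: at the point `x`,
`(div P)(β) = ∑ᵢ (∇_{eᵢ} P)(eⁱ, β)` for a basis `(eᵢ)` of the tangent space and its dual basis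
`(eⁱ)` (extended to 1-forms). -/
noncomputable def divBivector [IsManifold I ∞ M]
    (cov : CovariantDerivative I E (TangentSpace I : M → Type _))
    (P : ∀ y : M, TwoTensor I y) (β : ∀ y : M, CotangentSpace I y) (x : M) : ℝ :=
  let e := finBasis ℝ (TangentSpace I x)
  ∑ i, covDerivBivector cov P
    (fun y ↦ FiberBundle.extend (E →L[ℝ] ℝ) (E := fun y : M ↦ CotangentSpace I y) (x := x)
      (LinearMap.toContinuousLinearMap (e.coord i)) y) β x (e i)

/-! ### Killing-Poisson tensors on a Riemannian manifold -/

/-- A connection on the tangent bundle is the Levi-Civita connection if it is torsion-free and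
compatible with the metric. -/
structure IsLeviCivita [IsManifold I ∞ M] [RiemannianBundle (fun x : M ↦ TangentSpace I x)]
    [IsContMDiffRiemannianBundle I ∞ E (fun x : M ↦ TangentSpace I x)]
    (cov : CovariantDerivative I E (TangentSpace I : M → Type _)) : Prop where
  torsion_eq_zero : cov.torsion = 0
  metric : ∀ (x : M) (v : TangentSpace I x) (X Y : ∀ y : M, TangentSpace I y),
    MDifferentiableAt I I.tangent (fun y ↦ (⟨y, X y⟩ : TangentBundle I M)) x →
    MDifferentiableAt I I.tangent (fun y ↦ (⟨y, Y y⟩ : TangentBundle I M)) x →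
    mvfderiv I (fun y ↦ inner ℝ (X y) (Y y)) x v
      = inner ℝ (cov X x v) (Y x) + inner ℝ (X x) (cov Y x v)

/-- The gradient of `f` at `x`: the vector with `⟨∇f, Y⟩ = df(Y)` for all `Y`. -/
noncomputable def gradient [RiemannianBundle (fun x : M ↦ TangentSpace I x)]
    (f : M → ℝ) (x : M) : TangentSpace I x :=
  (InnerProductSpace.toDual ℝ (TangentSpace I x)).symm (mvfderiv I f x)

theorem inner_gradient [RiemannianBundle (fun x : M ↦ TangentSpace I x)]
    (f : M → ℝ) (x : M) (v : TangentSpace I x) :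
    inner ℝ (gradient f x) v = mvfderiv I f x v := by
  simp [gradient]

/-- `P` is a Killing-Poisson tensor on a Riemannian manifold. The Levi-Civita connection is
unique as an operator on differentiable vector fields, but not literally as a term of the
type `CovariantDerivative`, whose values on non-differentiable fields are arbitrary; so the first
condition says that a Levi-Civita connection exists and that the divergence of `P` with respect
to it, whichever term represents it, vanishes. The second one says that `L_{∇f} P = 0` on `U` for
every smooth function `f` on an open set `U` that is a Casimir function there. -/
structure IsKillingPoissonTensor [IsManifold I ∞ M]
    [RiemannianBundle (fun x : M ↦ TangentSpace I x)]
    [IsContMDiffRiemannianBundle I ∞ E (fun x : M ↦ TangentSpace I x)]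
    (P : ∀ x : M, TwoTensor I x) : Prop extends IsPoissonTensor P where
  exists_leviCivita : ∃ cov : CovariantDerivative I E (TangentSpace I : M → Type _),
    IsLeviCivita cov
  div_eq_zero : ∀ cov : CovariantDerivative I E (TangentSpace I : M → Type _), IsLeviCivita cov →
    ∀ (x : M) (β : ∀ y : M, CotangentSpace I y), SmoothOneFormAt β x → divBivector cov P β x = 0
  lieDeriv_gradient_eq_zero : ∀ (U : Set M) (f : M → ℝ), IsOpen U → ContMDiffOn I 𝓘(ℝ) ∞ f U →
    (∀ x ∈ U, P x (mvfderiv I f x) = 0) →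
    ∀ x ∈ U, ∀ α β : ∀ y : M, CotangentSpace I y, SmoothOneFormAt α x → SmoothOneFormAt β x →
      lieDerivBivector (gradient f) P α β x = 0

end Manifold

/-! ### Invariant tensors on a Lie group -/

section LieGroup

variable {E : Type*} [NormedAddCommGroup E] [NormedSpace ℝ E]
  {H : Type*} [TopologicalSpace H] {I : ModelWithCorners ℝ E H}
  {G : Type*} [TopologicalSpace G] [ChartedSpace H G] [Group G]

instance instLieGroupMinSmoothness [LieGroup I ∞ G] : LieGroup I (minSmoothness ℝ 3) G :=
  LieGroup.of_le (n := ∞) (by simpa using ENat.LEInfty.out)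

/-- `P` is left-invariant: `(L_a)_* P = P` for every left translation `L_a x = a * x`. -/
def IsLeftInvariant (P : ∀ x : G, TwoTensor I x) : Prop :=
  ∀ (a x : G) (α β : CotangentSpace I (a * x)),
    P (a * x) α β =
      P x (α.comp (mfderiv I I (fun y ↦ a * y) x)) (β.comp (mfderiv I I (fun y ↦ a * y) x))

/-- The Riemannian metric is right-invariant: all right translations are isometries. -/
def IsRightInvariantMetric (I : ModelWithCorners ℝ E H) (G : Type*) [TopologicalSpace G]
    [ChartedSpace H G] [Group G] [RiemannianBundle (fun x : G ↦ TangentSpace I x)] : Prop :=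
  ∀ (a x : G) (v w : TangentSpace I x),
    inner ℝ (mfderiv I I (fun y ↦ y * a) x v : TangentSpace I (x * a))
      (mfderiv I I (fun y ↦ y * a) x w : TangentSpace I (x * a)) = inner ℝ v w

/-- The value `P(1)` of a bivector field at the unit, as a bilinear form on the dual of the
Lie algebra. -/
noncomputable def valueAtOne [FiniteDimensional ℝ E] (P : ∀ x : G, TwoTensor I x) :
    Dual ℝ (GroupLieAlgebra I G) →ₗ[ℝ] Dual ℝ (GroupLieAlgebra I G) →ₗ[ℝ] ℝ :=
  LinearMap.mk₂ ℝ
    (fun α β ↦ P 1 (LinearMap.toContinuousLinearMap α) (LinearMap.toContinuousLinearMap β))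
    (by intros; simp) (by intros; simp) (by intros; simp) (by intros; simp)

/-- A left-invariant Poisson tensor on a Lie group is unimodular if its value at the unit is a
unimodular solution of the classical Yang-Baxter equation. -/
def IsUnimodularLeftInvariantPoisson [FiniteDimensional ℝ E] [LieGroup I ∞ G]
    (P : ∀ x : G, TwoTensor I x) : Prop :=
  IsPoissonTensor P ∧ IsLeftInvariant P ∧ IsUnimodularYangBaxterSolution (valueAtOne P)

end LieGroup

end KillingPoisson

namespace KillingPoisson

open Set Function Filter VectorField Topology

section Calculus

variable {E : Type*} [NormedAddCommGroup E] [NormedSpace ℝ E]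
  {H : Type*} [TopologicalSpace H] {I : ModelWithCorners ℝ E H}
  {M : Type*} [TopologicalSpace M] [ChartedSpace H M]
  {F : Type*} [NormedAddCommGroup F] [NormedSpace ℝ F]

/-- Derivatives of functions that agree near a point agree at this point. -/
theorem mvfderiv_congr {f g : M → F} {x : M} (h : f =ᶠ[𝓝 x] g) :
    mvfderiv I f x = mvfderiv I g x := by
  exact h.mfderiv_eq (I := I) (I' := 𝓘(ℝ, F))

theorem mvfderiv_eq_fderiv [I.Boundaryless] {f : M → F} {x : M}
    (hf : MDifferentiableAt I 𝓘(ℝ, F) f x) (v : TangentSpace I x) :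
    mvfderiv I f x v = fderiv ℝ (f ∘ (extChartAt I x).symm) (extChartAt I x x) v := by
  rw [hf.mvfderiv, I.range_eq_univ, fderivWithin_univ]
  rfl

/-- The pullback of a vector field to the model space by the inverse of the chart at `x`. -/
noncomputable def chartPullback (I : ModelWithCorners ℝ E H) (x : M)
    (V : ∀ y : M, TangentSpace I y) : E → E :=
  mpullbackWithin 𝓘(ℝ, E) I (extChartAt I x).symm V (range I)

theorem differentiableAt_chartPullback [I.Boundaryless] [IsManifold I 2 M] [CompleteSpace E]
    {V : ∀ y : M, TangentSpace I y} {x : M}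
    (hV : MDifferentiableAt I I.tangent (fun y ↦ (⟨y, V y⟩ : TangentBundle I M)) x) :
    DifferentiableAt ℝ (chartPullback I x V) (extChartAt I x x) := by
  have := (mdifferentiableWithinAt_univ.2
    hV).differentiableWithinAt_mpullbackWithin_vectorField (I := I)
  rw [preimage_univ, univ_inter] at this
  exact this.differentiableAt (by rw [I.range_eq_univ]; exact univ_mem)

theorem fderiv_chartPullback [I.Boundaryless] [IsManifold I 1 M] {f : M → F} {x y : M}
    (hy : y ∈ (extChartAt I x).source) (hf : MDifferentiableAt I 𝓘(ℝ, F) f y)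
    (V : ∀ y : M, TangentSpace I y) :
    fderiv ℝ (f ∘ (extChartAt I x).symm) (extChartAt I x y)
      (chartPullback I x V (extChartAt I x y)) = mvfderiv I f y (V y) := by
  have ht := (extChartAt I x).map_source hy
  have hinv := (extChartAt I x).left_inv hy
  have hi := isInvertible_mfderivWithin_extChartAt_symm (I := I) ht
  have hd := mdifferentiableWithinAt_extChartAt_symm (I := I) ht
  have hA : mfderiv 𝓘(ℝ, E) 𝓘(ℝ, F) (f ∘ (extChartAt I x).symm) (extChartAt I x y) =
      (mfderiv I 𝓘(ℝ, F) f ((extChartAt I x).symm (extChartAt I x y))).comp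
        (mfderivWithin 𝓘(ℝ, E) I (extChartAt I x).symm (range I) (extChartAt I x y)) := by
    rw [← mfderivWithin_univ, ← I.range_eq_univ]
    exact mfderiv_comp_mfderivWithin (I' := I) _ (by rw [hinv]; exact hf) hd
      (I.uniqueMDiffOn _ (by rw [I.range_eq_univ]; trivial))
  have key : mfderivWithin 𝓘(ℝ, E) I (extChartAt I x).symm (range I) (extChartAt I x y)
      (chartPullback (E := E) I x V (extChartAt I x y)) = V ((extChartAt I x).symm (extChartAt I x y)) := by
    obtain ⟨e, he⟩ := hi
    have h : chartPullback (E := E) I x V (extChartAt I x y) =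
        e.symm (V ((extChartAt I x).symm (extChartAt I x y))) := by
      unfold chartPullback
      rw [mpullbackWithin_apply, ← he, ContinuousLinearMap.inverse_equiv]
      rfl
    rw [h, ← he]
    exact e.apply_symm_apply _
  refine (DFunLike.congr_fun (mfderiv_eq_fderiv (𝕜 := ℝ) (f := f ∘ (extChartAt I x).symm)
    (x := extChartAt I x y)).symm (chartPullback (E := E) I x V (extChartAt I x y))).trans ?_
  refine (DFunLike.congr_fun hA (chartPullback (E := E) I x V (extChartAt I x y))).trans ?_
  refine (congrArg (mfderiv I 𝓘(ℝ, F) f ((extChartAt I x).symm (extChartAt I x y))) key).trans ?_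
  rw [hinv]
  rfl

theorem contDiffAt_comp_extChartAt_symm [I.Boundaryless] {n : ℕ∞ω} [IsManifold I n M]
    {f : M → F} {x : M}
    (hf : ContMDiffAt I 𝓘(ℝ, F) n f x) :
    ContDiffAt ℝ n (f ∘ (extChartAt I x).symm) (extChartAt I x x) := by
  have := (contMDiffAt_iff.1 hf).2
  rw [I.range_eq_univ, contDiffWithinAt_univ] at this
  exact this

theorem eventually_mdifferentiableAt {f : M → F} {x : M} [IsManifold I 2 M]
    (hf : ContMDiffAt I 𝓘(ℝ, F) 2 f x) :
    ∀ᶠ y in 𝓝 x, MDifferentiableAt I 𝓘(ℝ, F) f y := by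
  filter_upwards [(contMDiffAt_iff_contMDiffAt_nhds (by simp)).1 hf] with y hy
  exact hy.mdifferentiableAt (by simp)

theorem eventuallyEq_fderiv_chartPullback [I.Boundaryless] [IsManifold I 2 M] {f : M → F} {x : M}
    (hf : ContMDiffAt I 𝓘(ℝ, F) 2 f x) (W : ∀ y : M, TangentSpace I y) :
    (fun y ↦ mvfderiv I f y (W y)) ∘ (extChartAt I x).symm =ᶠ[𝓝 (extChartAt I x x)]
      fun s ↦ fderiv ℝ (f ∘ (extChartAt I x).symm) s (chartPullback I x W s) := by
  have : IsManifold I 1 M := .of_le (n := 2) (by norm_num)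
  have h1 := (continuousAt_extChartAt_symm (I := I) x)
  rw [ContinuousAt, extChartAt_to_inv] at h1
  filter_upwards [h1.eventually (eventually_mdifferentiableAt hf), extChartAt_target_mem_nhds x]
    with s hs ht
  have := fderiv_chartPullback ((extChartAt I x).map_target ht) hs W
  rw [(extChartAt I x).right_inv ht] at this
  exact this.symm

theorem mdifferentiableAt_of_comp_extChartAt_symm [IsManifold I 1 M] {f : M → F} {x : M}
    (hf : DifferentiableAt ℝ (f ∘ (extChartAt I x).symm) (extChartAt I x x)) :
    MDifferentiableAt I 𝓘(ℝ, F) f x := by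
  have h := hf.mdifferentiableAt.comp x (mdifferentiableAt_extChartAt (I := I)
    (mem_chart_source H x))
  refine h.congr_of_eventuallyEq ?_
  filter_upwards [extChartAt_source_mem_nhds (I := I) x] with y hy
  rw [comp_apply, comp_apply, (extChartAt I x).left_inv hy]

theorem differentiableAt_fderiv_apply {f : E → F} {W : E → E} {s : E}
    (hf : ContDiffAt ℝ 2 f s) (hW : DifferentiableAt ℝ W s) :
    DifferentiableAt ℝ (fun t ↦ fderiv ℝ f t (W t)) s :=
  ((hf.fderiv_right (m := 1) (by norm_num)).differentiableAt (by simp)).clm_apply hW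

/-- The derivative of a `C²` function along a differentiable vector field is differentiable. -/
theorem mdifferentiableAt_mvfderiv_apply [I.Boundaryless] [IsManifold I 2 M] [CompleteSpace E]
    {f : M → F} {x : M} (hf : ContMDiffAt I 𝓘(ℝ, F) 2 f x) {W : ∀ y : M, TangentSpace I y}
    (hW : MDifferentiableAt I I.tangent (fun y ↦ (⟨y, W y⟩ : TangentBundle I M)) x) :
    MDifferentiableAt I 𝓘(ℝ, F) (fun y ↦ mvfderiv I f y (W y)) x := by
  have : IsManifold I 1 M := .of_le (n := 2) (by norm_num)
  refine mdifferentiableAt_of_comp_extChartAt_symm ?_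
  exact (differentiableAt_fderiv_apply (contDiffAt_comp_extChartAt_symm hf)
    (differentiableAt_chartPullback hW)).congr_of_eventuallyEq
      (eventuallyEq_fderiv_chartPullback hf W)

/-- The derivative of a function along a Lie bracket is the commutator of the derivatives. -/
theorem mvfderiv_mlieBracket [I.Boundaryless] [IsManifold I 2 M] [CompleteSpace E]
    {f : M → F} {x : M} (hf : ContMDiffAt I 𝓘(ℝ, F) 2 f x) {V W : ∀ y : M, TangentSpace I y}
    (hV : MDifferentiableAt I I.tangent (fun y ↦ (⟨y, V y⟩ : TangentBundle I M)) x)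
    (hW : MDifferentiableAt I I.tangent (fun y ↦ (⟨y, W y⟩ : TangentBundle I M)) x) :
    mvfderiv I f x (mlieBracket I V W x) =
      mvfderiv I (fun y ↦ mvfderiv I f y (W y)) x (V x)
        - mvfderiv I (fun y ↦ mvfderiv I f y (V y)) x (W x) := by
  have : IsManifold I 1 M := .of_le (n := 2) (by norm_num)
  have hxs := mem_extChartAt_source (I := I) x
  have hbr : chartPullback I x (mlieBracket I V W) (extChartAt I x x) =
      lieBracket ℝ (chartPullback I x V) (chartPullback I x W) (extChartAt I x x) := by
    rw [chartPullback, mpullbackWithin_apply, extChartAt_to_inv,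
      ← mlieBracketWithin_univ, mlieBracketWithin_apply]
    have h1 := isInvertible_mfderiv_extChartAt (I := I) hxs
    have h2 := mfderivWithin_extChartAt_symm_comp_mfderiv_extChartAt' (I := I) hxs
    have h3 := mfderiv_extChartAt_comp_mfderivWithin_extChartAt_symm' (I := I) hxs
    rw [← ContinuousLinearMap.inverse_eq h3 h2]
    obtain ⟨e, he⟩ := h1
    rw [← he, ContinuousLinearMap.inverse_equiv, ContinuousLinearMap.inverse_equiv]
    refine (e.apply_symm_apply _).trans ?_
    unfold chartPullback
    simp only [I.range_eq_univ, preimage_univ, inter_univ]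
    exact congrFun (lieBracketWithin_univ (𝕜 := ℝ) (E := E)) _
  rw [← fderiv_chartPullback hxs (hf.mdifferentiableAt (by simp)), hbr,
    ← fderiv_chartPullback hxs (mdifferentiableAt_mvfderiv_apply hf hW),
    ← fderiv_chartPullback hxs (mdifferentiableAt_mvfderiv_apply hf hV),
    (eventuallyEq_fderiv_chartPullback hf W).fderiv_eq,
    (eventuallyEq_fderiv_chartPullback hf V).fderiv_eq]
  exact fderiv_apply_lieBracket (n := 2) (contDiffAt_comp_extChartAt_symm hf)
    (by simp) (differentiableAt_chartPullback hW)
    (differentiableAt_chartPullback hV)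

theorem fderiv_fderiv_comm {E' : Type*} [NormedAddCommGroup E'] [NormedSpace ℝ E']
    {h : E × E' → F} {s₀ : E} {t₀ : E'} (hh : ContDiffAt ℝ 2 h (s₀, t₀)) (v : E) (w : E') :
    DifferentiableAt ℝ (fun s ↦ fderiv ℝ (fun t ↦ h (s, t)) t₀ w) s₀ ∧
    fderiv ℝ (fun s ↦ fderiv ℝ (fun t ↦ h (s, t)) t₀ w) s₀ v =
      fderiv ℝ (fun t ↦ fderiv ℝ (fun s ↦ h (s, t)) s₀ v) t₀ w := by
  have hd : DifferentiableAt ℝ (fderiv ℝ h) (s₀, t₀) :=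
    (hh.fderiv_right (m := 1) (by norm_num)).differentiableAt (by simp)
  have hevh : ∀ᶠ s in 𝓝 (s₀, t₀), DifferentiableAt ℝ h s := by
    filter_upwards [hh.eventually (by simp)] with s hs
    exact hs.differentiableAt (by simp)
  have c1 : ContinuousAt (fun s : E ↦ (s, t₀)) s₀ := by fun_prop
  have c2 : ContinuousAt (fun t : E' ↦ (s₀, t)) t₀ := by fun_prop
  have e1 : (fun s ↦ fderiv ℝ (fun t ↦ h (s, t)) t₀ w) =ᶠ[𝓝 s₀]
      fun s ↦ fderiv ℝ h (s, t₀) (0, w) := by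
    filter_upwards [c1.eventually hevh] with s hs
    exact congrArg (fun A ↦ A w) (hs.hasFDerivAt.comp t₀ (hasFDerivAt_prodMk_right s t₀)).fderiv
  have e2 : (fun t ↦ fderiv ℝ (fun s ↦ h (s, t)) s₀ v) =ᶠ[𝓝 t₀]
      fun t ↦ fderiv ℝ h (s₀, t) (v, 0) := by
    filter_upwards [c2.eventually hevh] with t ht
    exact congrArg (fun A ↦ A v)
      (ht.hasFDerivAt.comp s₀ (hasFDerivAt_prodMk_left (𝕜 := ℝ) s₀ t)).fderiv
  have h1 := (hd.hasFDerivAt.comp s₀ (hasFDerivAt_prodMk_left (𝕜 := ℝ) s₀ t₀)).clm_apply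
    (hasFDerivAt_const ((0, w) : E × E') s₀)
  have h2 := (hd.hasFDerivAt.comp t₀ (hasFDerivAt_prodMk_right (𝕜 := ℝ) s₀ t₀)).clm_apply
    (hasFDerivAt_const ((v, 0) : E × E') t₀)
  refine ⟨h1.differentiableAt.congr_of_eventuallyEq e1, ?_⟩
  rw [e1.fderiv_eq, e2.fderiv_eq]
  refine (congrArg (fun A ↦ A v) h1.fderiv).trans ?_
  refine Eq.trans ?_ (congrArg (fun A ↦ A w) h2.fderiv).symm
  have hsymm := hh.isSymmSndFDerivAt (by simp) ((v, 0) : E × E') (0, w)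
  simpa [ContinuousLinearMap.flip_apply] using hsymm

theorem mvfderiv_mvfderiv_eq_fderiv [I.Boundaryless] [IsManifold I 2 M]
    {E' : Type*} [NormedAddCommGroup E'] [NormedSpace ℝ E']
    {H' : Type*} [TopologicalSpace H'] {J : ModelWithCorners ℝ E' H'} [J.Boundaryless]
    {N : Type*} [TopologicalSpace N] [ChartedSpace H' N] [IsManifold J 2 N]
    {g : M × N → F} {p : M} {q : N} (hg : ContMDiffAt (I.prod J) 𝓘(ℝ, F) 2 g (p, q))
    (v : TangentSpace I p) (w : TangentSpace J q) :
    mvfderiv I (fun a ↦ mvfderiv J (fun b ↦ g (a, b)) q w) p v =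
      fderiv ℝ (fun s ↦ fderiv ℝ
        (fun t ↦ g ((extChartAt I p).symm s, (extChartAt J q).symm t)) (extChartAt J q q) w)
        (extChartAt I p p) v := by
  have : IsManifold I 1 M := .of_le (n := 2) (by norm_num)
  have hh : ContDiffAt ℝ 2 (fun s : E × E' ↦ g ((extChartAt I p).symm s.1,
      (extChartAt J q).symm s.2)) (extChartAt I p p, extChartAt J q q) := by
    have := contDiffAt_comp_extChartAt_symm hg
    rw [extChartAt_prod] at this
    exact this
  have hk : (fun a ↦ mvfderiv J (fun b ↦ g (a, b)) q w) ∘ (extChartAt I p).symm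
      =ᶠ[𝓝 (extChartAt I p p)] fun s ↦ fderiv ℝ (fun t ↦ g ((extChartAt I p).symm s,
        (extChartAt J q).symm t)) (extChartAt J q q) w := by
    have c : Tendsto (fun s : E ↦ ((extChartAt I p).symm s, q)) (𝓝 (extChartAt I p p))
        (𝓝 (p, q)) := by
      have : ContinuousAt (fun s : E ↦ ((extChartAt I p).symm s, q)) (extChartAt I p p) :=
        (continuousAt_extChartAt_symm p).prodMk continuousAt_const
      rwa [ContinuousAt, extChartAt_to_inv] at this
    filter_upwards [c.eventually (eventually_mdifferentiableAt hg)] with s hs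
    exact mvfderiv_eq_fderiv (hs.comp (I' := I.prod J) q
      (mdifferentiableAt_const.prodMk mdifferentiableAt_id)) w
  rw [mvfderiv_eq_fderiv, hk.fderiv_eq]
  exact mdifferentiableAt_of_comp_extChartAt_symm
    ((fderiv_fderiv_comm hh v w).1.congr_of_eventuallyEq hk)

/-- Partial derivatives in the two factors of a product commute. -/
theorem mvfderiv_mvfderiv_comm [I.Boundaryless] [IsManifold I 2 M]
    {E' : Type*} [NormedAddCommGroup E'] [NormedSpace ℝ E']
    {H' : Type*} [TopologicalSpace H'] {J : ModelWithCorners ℝ E' H'} [J.Boundaryless]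
    {N : Type*} [TopologicalSpace N] [ChartedSpace H' N] [IsManifold J 2 N]
    {g : M × N → F} {p : M} {q : N} (hg : ContMDiffAt (I.prod J) 𝓘(ℝ, F) 2 g (p, q))
    (v : TangentSpace I p) (w : TangentSpace J q) :
    mvfderiv I (fun a ↦ mvfderiv J (fun b ↦ g (a, b)) q w) p v =
      mvfderiv J (fun b ↦ mvfderiv I (fun a ↦ g (a, b)) p v) q w := by
  have hh : ContDiffAt ℝ 2 (fun s : E × E' ↦ g ((extChartAt I p).symm s.1,
      (extChartAt J q).symm s.2)) (extChartAt I p p, extChartAt J q q) := by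
    have := contDiffAt_comp_extChartAt_symm hg
    rw [extChartAt_prod] at this
    exact this
  have hg' : ContMDiffAt (J.prod I) 𝓘(ℝ, F) 2 (g ∘ Prod.swap) (q, p) :=
    hg.comp (I' := I.prod J) (q, p) (contMDiffAt_snd.prodMk contMDiffAt_fst)
  rw [mvfderiv_mvfderiv_eq_fderiv hg]
  exact (fderiv_fderiv_comm hh v w).2.trans (mvfderiv_mvfderiv_eq_fderiv hg' w v).symm

end Calculus

section Contraction

variable {𝔤 : Type*} [LieRing 𝔤] [LieAlgebra ℝ 𝔤] [FiniteDimensional ℝ 𝔤]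

theorem IsYangBaxterSolution.skew {r : Dual ℝ 𝔤 →ₗ[ℝ] Dual ℝ 𝔤 →ₗ[ℝ] ℝ}
    (hr : IsYangBaxterSolution r) (α β : Dual ℝ 𝔤) : r α β = - r β α := by
  have h := hr.alternating (α + β)
  simp only [map_add, LinearMap.add_apply, hr.alternating, zero_add, add_zero] at h
  linarith

theorem IsYangBaxterSolution.apply_sharp_skew {r : Dual ℝ 𝔤 →ₗ[ℝ] Dual ℝ 𝔤 →ₗ[ℝ] ℝ}
    (hr : IsYangBaxterSolution r) (α β : Dual ℝ 𝔤) : α (sharp r β) = - β (sharp r α) := by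
  rw [apply_sharp, apply_sharp, hr.skew]

theorem sharp_eq_sum {ι : Type*} [Fintype ι] (b : Basis ι ℝ 𝔤)
    (r : Dual ℝ 𝔤 →ₗ[ℝ] Dual ℝ 𝔤 →ₗ[ℝ] ℝ) (β : Dual ℝ 𝔤) :
    sharp r β = ∑ k, r (b.coord k) β • b k := by
  rw [← b.sum_repr (sharp r β)]
  refine Finset.sum_congr rfl fun k _ ↦ ?_
  rw [← apply_sharp, Basis.coord_apply]

omit [FiniteDimensional ℝ 𝔤] in
theorem sum_coord_mul_apply {ι : Type*} [Fintype ι] (b : Basis ι ℝ 𝔤)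
    (r : Dual ℝ 𝔤 →ₗ[ℝ] Dual ℝ 𝔤 →ₗ[ℝ] ℝ) (φ ψ : Dual ℝ 𝔤) :
    ∑ k, ∑ l, r (b.coord k) (b.coord l) * (φ (b k) * ψ (b l)) = r φ ψ := by
  classical
  have hdual : ∀ α : Dual ℝ 𝔤, ∑ k, α (b k) • b.coord k = α := by
    intro α
    refine b.ext fun i ↦ ?_
    simp
  conv_rhs => rw [← hdual φ, ← hdual ψ]
  simp only [map_sum, map_smul, LinearMap.sum_apply, LinearMap.smul_apply, smul_eq_mul,
    Finset.mul_sum]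
  rw [Finset.sum_comm]
  refine Finset.sum_congr rfl fun k _ ↦ Finset.sum_congr rfl fun l _ ↦ ?_
  ring

/-- The contraction of a solution of the classical Yang-Baxter equation with the Lie bracket
vanishes if the image of the solution is unimodular. -/
theorem IsUnimodularYangBaxterSolution.sum_smul_lie_eq_zero
    {r : Dual ℝ 𝔤 →ₗ[ℝ] Dual ℝ 𝔤 →ₗ[ℝ] ℝ} (h : IsUnimodularYangBaxterSolution r)
    {ι : Type*} [Fintype ι] (b : Basis ι ℝ 𝔤) :
    ∑ k, ∑ l, r (b.coord k) (b.coord l) • ⁅b k, b l⁆ = 0 := by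
  obtain ⟨hr, hu⟩ := h
  set S : Submodule ℝ 𝔤 := LinearMap.range (sharp r)
  have hmem : ∀ β, sharp r β ∈ S := fun β ↦ LinearMap.mem_range_self _ β
  obtain ⟨p, hp⟩ := S.subtype.exists_leftInverse_of_injective S.ker_subtype
  have hp' : ∀ u : S, p u = u := fun u ↦ LinearMap.congr_fun hp u
  let u := finBasis ℝ S
  let γ : Fin (finrank ℝ S) → Dual ℝ 𝔤 := fun i ↦ u.coord i ∘ₗ p
  have hγ : ∀ x ∈ S, ∑ i, γ i x • (u i : 𝔤) = x := by
    intro x hx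
    have := congrArg S.subtype (u.sum_repr ⟨x, hx⟩)
    simp only [map_sum, map_smul, Submodule.subtype_apply] at this
    rw [← this]
    refine Finset.sum_congr rfl fun i _ ↦ ?_
    rw [this]
    simp only [γ, LinearMap.comp_apply, Basis.coord_apply]
    rw [hp' ⟨x, hx⟩]
  choose δ hδ using fun i ↦ (u i).2
  -- the trace of `ad w` on the image of `r`
  have htr : ∀ w ∈ S, ∑ i, γ i ⁅w, (u i : 𝔤)⁆ = 0 := by
    intro w hw
    have h1 := hu ⟨w, hw⟩
    let u' : Basis (Fin (finrank ℝ S)) ℝ (imageSubalgebra r hr) := u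
    rw [LinearMap.trace_eq_matrix_trace ℝ u', Matrix.trace] at h1
    rw [← h1]
    refine Finset.sum_congr rfl fun i _ ↦ ?_
    rw [Matrix.diag_apply, LinearMap.toMatrix_apply]
    have h2 : ((LieAlgebra.ad ℝ (imageSubalgebra r hr) ⟨w, hw⟩ (u i) : imageSubalgebra r hr) : 𝔤)
      = ⁅w, (u i : 𝔤)⁆ := rfl
    simp only [γ, LinearMap.comp_apply, Basis.coord_apply]
    rw [← h2]
    exact congrArg (fun z ↦ u.repr z i)
      (hp' (LieAlgebra.ad ℝ (imageSubalgebra r hr) ⟨w, hw⟩ (u i)))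
  have hsum : ∑ k, ∑ l, r (b.coord k) (b.coord l) • ⁅b k, b l⁆ =
      ∑ i, ⁅sharp r (γ i), (u i : 𝔤)⁆ := by
    rw [Finset.sum_comm]
    have h1 : ∀ l, ∑ k, r (b.coord k) (b.coord l) • ⁅b k, b l⁆ =
        ∑ i, - (b.coord l (sharp r (γ i)) • ⁅(u i : 𝔤), b l⁆) := by
      intro l
      simp_rw [← smul_lie]
      rw [← sum_lie, ← sharp_eq_sum b r, ← hγ _ (hmem (b.coord l)), sum_lie]
      refine Finset.sum_congr rfl fun i _ ↦ ?_
      rw [hr.apply_sharp_skew, neg_smul, neg_lie]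
    simp_rw [h1]
    rw [Finset.sum_comm]
    refine Finset.sum_congr rfl fun i _ ↦ ?_
    rw [Finset.sum_neg_distrib, ← lie_skew]
    congr 1
    simp_rw [← lie_smul, Basis.coord_apply]
    rw [← lie_sum, b.sum_repr]
  rw [hsum, ← forall_dual_apply_eq_zero_iff ℝ]
  intro θ
  set w := sharp r θ
  have hyb : ∀ i, θ ⁅sharp r (γ i), (u i : 𝔤)⁆ =
      γ i ⁅w, (u i : 𝔤)⁆ - δ i ⁅w, sharp r (γ i)⁆ := by
    intro i
    have := hr.yangBaxter θ (γ i) (δ i)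
    rw [hδ] at this
    rw [← lie_skew (u i : 𝔤) w, map_neg] at this
    linarith
  rw [map_sum]
  simp_rw [hyb]
  rw [Finset.sum_sub_distrib, htr w (hmem θ), zero_sub, neg_eq_zero]
  have hswap : ∀ i, δ i ⁅w, sharp r (γ i)⁆ = ∑ j, γ j (sharp r (γ i)) * δ i ⁅w, (u j : 𝔤)⁆ := by
    intro i
    conv_lhs => rw [← hγ _ (hmem (γ i)), lie_sum]
    simp [lie_smul]
  have hδγ : ∀ j, ∀ x ∈ S, ∑ i, γ i (sharp r (γ j)) * δ i x = γ j x := by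
    rintro j _ ⟨ε, rfl⟩
    simp_rw [hr.apply_sharp_skew _ ε, hδ, mul_neg]
    rw [Finset.sum_neg_distrib, neg_inj]
    conv_rhs => rw [← hγ _ (hmem (γ j))]
    simp
  simp_rw [hswap]
  rw [Finset.sum_comm]
  rw [← neg_eq_zero, ← Finset.sum_neg_distrib, ← htr w (hmem θ)]
  refine Finset.sum_congr rfl fun j _ ↦ ?_
  have hwS : ⁅w, (u j : 𝔤)⁆ ∈ S := (imageSubalgebra r hr).lie_mem (hmem θ) (u j).2
  rw [← hδγ j _ hwS, ← Finset.sum_neg_distrib]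
  refine Finset.sum_congr rfl fun i _ ↦ ?_
  rw [hr.apply_sharp_skew (γ j) (γ i), neg_mul, neg_neg]

end Contraction

section LieGroupFields

variable {E : Type*} [NormedAddCommGroup E] [NormedSpace ℝ E]
  {H : Type*} [TopologicalSpace H] {I : ModelWithCorners ℝ E H}
  {G : Type*} [TopologicalSpace G] [ChartedSpace H G] [Group G]
  {F : Type*} [NormedAddCommGroup F] [NormedSpace ℝ F]

/-- The right-invariant vector field with value `w` at the unit. -/
noncomputable def rightInvariantField (w : GroupLieAlgebra I G) (g : G) : TangentSpace I g :=
  mfderiv I I (fun a ↦ a * g) (1 : G) w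

variable [LieGroup I ∞ G]

theorem mdifferentiableAt_mul_left (a x : G) : MDifferentiableAt I I (fun y ↦ a * y) x :=
  (contMDiff_mul_left (I := I) (n := ∞) (a := a)).mdifferentiable (by simp) x

theorem mdifferentiableAt_mul_right (a x : G) : MDifferentiableAt I I (fun y ↦ y * a) x :=
  (contMDiff_mul_right (I := I) (n := ∞) (a := a)).mdifferentiable (by simp) x

theorem contMDiff_rightInvariantField (w : GroupLieAlgebra I G) :
    ContMDiff I I.tangent ∞ (fun g : G ↦ (⟨g, rightInvariantField w g⟩ : TangentBundle I G)) := by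
  let fg : G → TangentBundle I G := fun g ↦ TotalSpace.mk' E g 0
  have sfg : ContMDiff I I.tangent ∞ fg := contMDiff_zeroSection _ _
  let fv : G → TangentBundle I G := fun _ ↦ TotalSpace.mk' E 1 w
  have sfv : ContMDiff I I.tangent ∞ fv := contMDiff_const
  let F₁ : G → (TangentBundle I G × TangentBundle I G) := fun g ↦ (fv g, fg g)
  have S₁ : ContMDiff I (I.tangent.prod I.tangent) ∞ F₁ := sfv.prodMk sfg
  let F₂ : (TangentBundle I G × TangentBundle I G) → TangentBundle (I.prod I) (G × G) :=
    (equivTangentBundleProd I G I G).symm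
  have S₂ : ContMDiff (I.tangent.prod I.tangent) (I.prod I).tangent ∞ F₂ :=
    contMDiff_equivTangentBundleProd_symm
  let F₃ : TangentBundle (I.prod I) (G × G) → TangentBundle I G :=
    tangentMap (I.prod I) I (fun (p : G × G) ↦ p.1 * p.2)
  have S₃ : ContMDiff (I.prod I).tangent I.tangent ∞ F₃ :=
    (contMDiff_mul I ∞).contMDiff_tangentMap (m := ∞) (by simp)
  let S := (S₃.comp S₂).comp S₁
  convert! S with g
  · simp [F₁, F₂, F₃, fg, fv]
  · simp only [comp_apply, tangentMap, F₃, F₂, F₁, fg, fv]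
    rw [mfderiv_prod_eq_add_apply ((contMDiff_mul I ∞).mdifferentiable (by simp) _)]
    simp +instances only [rightInvariantField]
    exact ((congrArg _ (map_zero (mfderiv I I (fun z : G ↦ 1 * z) g))).trans (add_zero _)).symm

theorem mdifferentiableAt_rightInvariantField (w : GroupLieAlgebra I G) (x : G) :
    MDifferentiableAt I I.tangent
      (fun g : G ↦ (⟨g, rightInvariantField w g⟩ : TangentBundle I G)) x :=
  (contMDiff_rightInvariantField w).mdifferentiable (by simp) x

theorem mvfderiv_rightInvariantField {f : G → F} {x : G} (hf : MDifferentiableAt I 𝓘(ℝ, F) f x)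
    (w : GroupLieAlgebra I G) :
    mvfderiv I f x (rightInvariantField w x) = mvfderiv I (fun a ↦ f (a * x)) 1 w :=
  (mfderiv_comp_apply_of_eq (I' := I) (1 : G) hf
    (mdifferentiableAt_mul_right (I := I) x (1 : G)) (one_mul x) w).symm

theorem mvfderiv_mulInvariantVectorField {f : G → F} {x : G}
    (hf : MDifferentiableAt I 𝓘(ℝ, F) f x) (v : GroupLieAlgebra I G) :
    mvfderiv I f x (mulInvariantVectorField v x) = mvfderiv I (fun b ↦ f (x * b)) 1 v :=
  (mfderiv_comp_apply_of_eq (I' := I) (1 : G) hf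
    (mdifferentiableAt_mul_left (I := I) x (1 : G)) (mul_one x) v).symm

variable [CompleteSpace E]

/-- The Lie bracket of left-invariant vector fields. -/
theorem mlieBracket_mulInvariantVectorField (v w : GroupLieAlgebra I G) (x : G) :
    mlieBracket I (mulInvariantVectorField v) (mulInvariantVectorField w) x =
      mulInvariantVectorField ⁅v, w⁆ x := by
  rw [GroupLieAlgebra.bracket_def, mulInvariantVector_mlieBracket]

variable [I.Boundaryless]

/-- Left-invariant and right-invariant vector fields commute, as derivations. -/
theorem mvfderiv_mulInvariant_rightInvariant_comm {f : G → F} {x : G}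
    (hf : ContMDiffAt I 𝓘(ℝ, F) 2 f x) (v w : GroupLieAlgebra I G) :
    mvfderiv I (fun y ↦ mvfderiv I f y (mulInvariantVectorField v y)) x (rightInvariantField w x) =
      mvfderiv I (fun y ↦ mvfderiv I f y (rightInvariantField w y)) x
        (mulInvariantVectorField v x) := by
  have : LieGroup I 2 G := .of_le (n := ∞) (by simpa using ENat.LEInfty.out)
  have hX : MDifferentiableAt I 𝓘(ℝ, F)
      (fun y ↦ mvfderiv I f y (mulInvariantVectorField v y)) x :=
    mdifferentiableAt_mvfderiv_apply hf (mdifferentiableAt_mulInvariantVectorField v)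
  have hR : MDifferentiableAt I 𝓘(ℝ, F) (fun y ↦ mvfderiv I f y (rightInvariantField w y)) x :=
    mdifferentiableAt_mvfderiv_apply hf (mdifferentiableAt_rightInvariantField w x)
  have hev := eventually_mdifferentiableAt hf
  rw [mvfderiv_rightInvariantField hX, mvfderiv_mulInvariantVectorField hR]
  have c1 : Tendsto (fun a : G ↦ a * x) (𝓝 1) (𝓝 x) := by
    have := (mdifferentiableAt_mul_right (I := I) x (1 : G)).continuousAt
    rwa [ContinuousAt, one_mul] at this
  have c2 : Tendsto (fun b : G ↦ x * b) (𝓝 1) (𝓝 x) := by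
    have := (mdifferentiableAt_mul_left (I := I) x (1 : G)).continuousAt
    rwa [ContinuousAt, mul_one] at this
  have e1 : (fun a ↦ mvfderiv I f (a * x) (mulInvariantVectorField v (a * x))) =ᶠ[𝓝 1]
      fun a ↦ mvfderiv I (fun b ↦ f (a * x * b)) 1 v := by
    filter_upwards [c1.eventually hev] with a ha
    exact mvfderiv_mulInvariantVectorField ha v
  have e2 : (fun b ↦ mvfderiv I f (x * b) (rightInvariantField w (x * b))) =ᶠ[𝓝 1]
      fun b ↦ mvfderiv I (fun a ↦ f (a * x * b)) 1 w := by
    filter_upwards [c2.eventually hev] with b hb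
    rw [mvfderiv_rightInvariantField hb w]
    simp_rw [mul_assoc]
  rw [mvfderiv_congr e1, mvfderiv_congr e2]
  refine mvfderiv_mvfderiv_comm (g := fun p : G × G ↦ f (p.1 * x * p.2)) ?_ w v
  have hm : ContMDiffAt (I.prod I) I 2 (fun p : G × G ↦ p.1 * x * p.2) (1, 1) :=
    (contMDiffAt_fst.mul contMDiffAt_const).mul contMDiffAt_snd
  refine ContMDiffAt.comp (I' := I) (g := f) ((1, 1) : G × G) ?_ hm
  simpa using hf

/-- The Lie bracket of a left-invariant and a right-invariant vector field vanishes. -/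
theorem mlieBracket_mulInvariant_rightInvariant (v w : GroupLieAlgebra I G) (x : G) :
    mlieBracket I (mulInvariantVectorField v) (rightInvariantField w) x = 0 := by
  have hf : ContMDiffAt I 𝓘(ℝ, E) 2 (extChartAt I x) x := contMDiffAt_extChartAt
  have h := mvfderiv_mlieBracket hf (mdifferentiableAt_mulInvariantVectorField v)
    (mdifferentiableAt_rightInvariantField w x)
  rw [mvfderiv_mulInvariant_rightInvariant_comm hf, sub_self] at h
  obtain ⟨e, he⟩ := isInvertible_mfderiv_extChartAt (I := I) (mem_extChartAt_source (I := I) x)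
  apply e.injective
  rw [map_zero]
  exact (DFunLike.congr_fun he _).trans h

end LieGroupFields

section Derivation

variable {E : Type*} [NormedAddCommGroup E] [NormedSpace ℝ E] [FiniteDimensional ℝ E]
  {H : Type*} [TopologicalSpace H] {I : ModelWithCorners ℝ E H}
  {M : Type*} [TopologicalSpace M] [ChartedSpace H M] [IsManifold I ∞ M]

omit [FiniteDimensional ℝ E] [IsManifold I ∞ M] in
theorem mdifferentiableAt_mvfderiv_finset_sum {ι : Type*} (s : Finset ι) {f : ι → M → ℝ} {x : M}
    (hf : ∀ i, MDifferentiableAt I 𝓘(ℝ) (f i) x) :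
    MDifferentiableAt I 𝓘(ℝ) (fun y ↦ ∑ i ∈ s, f i y) x ∧
      mvfderiv I (fun y ↦ ∑ i ∈ s, f i y) x = ∑ i ∈ s, mvfderiv I (f i) x := by
  classical
  induction s using Finset.induction_on with
  | empty => simpa using ⟨mdifferentiableAt_const, mvfderiv_const (I := I) (0 : ℝ)⟩
  | insert a s ha ih =>
    simp only [Finset.sum_insert ha]
    exact ⟨(hf a).add ih.1, by rw [mvfderiv_fun_add (hf a) ih.1, ih.2]⟩

omit [FiniteDimensional ℝ E] [IsManifold I ∞ M] in
theorem mvfderiv_finset_sum {ι : Type*} (s : Finset ι) {f : ι → M → ℝ} {x : M}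
    (hf : ∀ i, MDifferentiableAt I 𝓘(ℝ) (f i) x) :
    mvfderiv I (fun y ↦ ∑ i ∈ s, f i y) x = ∑ i ∈ s, mvfderiv I (f i) x :=
  (mdifferentiableAt_mvfderiv_finset_sum s hf).2

omit [FiniteDimensional ℝ E] [IsManifold I ∞ M] in
theorem mdifferentiableAt_finset_sum {ι : Type*} (s : Finset ι) {f : ι → M → ℝ} {x : M}
    (hf : ∀ i, MDifferentiableAt I 𝓘(ℝ) (f i) x) :
    MDifferentiableAt I 𝓘(ℝ) (fun y ↦ ∑ i ∈ s, f i y) x :=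
  (mdifferentiableAt_mvfderiv_finset_sum s hf).1

/-- `D` is a derivation of vector fields at the point `x` in the direction `v`. -/
structure IsDerivationAt (x : M) (v : TangentSpace I x)
    (D : (∀ y : M, TangentSpace I y) → TangentSpace I x) : Prop where
  add : ∀ {X Y : ∀ y : M, TangentSpace I y},
    MDifferentiableAt I I.tangent (fun y ↦ (⟨y, X y⟩ : TangentBundle I M)) x →
    MDifferentiableAt I I.tangent (fun y ↦ (⟨y, Y y⟩ : TangentBundle I M)) x →
    D (X + Y) = D X + D Y
  leibniz : ∀ {f : M → ℝ} {Y : ∀ y : M, TangentSpace I y}, MDifferentiableAt I 𝓘(ℝ) f x →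
    MDifferentiableAt I I.tangent (fun y ↦ (⟨y, Y y⟩ : TangentBundle I M)) x →
    D (f • Y) = f x • D Y + mvfderiv I f x v • Y x

omit [FiniteDimensional ℝ E] in
theorem IsDerivationAt.sum_smul {x : M} {v : TangentSpace I x}
    {D : (∀ y : M, TangentSpace I y) → TangentSpace I x} (hD : IsDerivationAt x v D)
    {ι : Type*} (s : Finset ι) {f : ι → M → ℝ} {Y : ι → ∀ y : M, TangentSpace I y}
    (hf : ∀ i, MDifferentiableAt I 𝓘(ℝ) (f i) x)
    (hY : ∀ i, MDifferentiableAt I I.tangent (fun y ↦ (⟨y, Y i y⟩ : TangentBundle I M)) x) :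
    D (fun y ↦ ∑ i ∈ s, f i y • Y i y) =
      ∑ i ∈ s, (f i x • D (Y i) + mvfderiv I (f i) x v • Y i x) := by
  classical
  have hfY : ∀ i, MDifferentiableAt I I.tangent
      (fun y ↦ (⟨y, f i y • Y i y⟩ : TangentBundle I M)) x := fun i ↦ (hf i).smul_section (hY i)
  induction s using Finset.induction_on with
  | empty =>
    have h0 : MDifferentiableAt I I.tangent
      (fun y ↦ (⟨y, (0 : ∀ y : M, TangentSpace I y) y⟩ : TangentBundle I M)) x :=
      mdifferentiable_zeroSection ℝ _ x
    have hD0 : D 0 = 0 := by simpa using hD.add h0 h0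
    simp only [Finset.sum_empty]
    exact hD0
  | insert a s ha ih =>
    simp only [Finset.sum_insert ha]
    rw [← ih, ← hD.leibniz (hf a) (hY a)]
    exact hD.add (hfY a) (.sum_section fun i _ ↦ hfY i)

omit [FiniteDimensional ℝ E] in
theorem isDerivationAt_mlieBracket [CompleteSpace E] (X : ∀ y : M, TangentSpace I y) (x : M) :
    IsDerivationAt x (X x) (fun Y ↦ mlieBracket I X Y x) where
  add hX hY := mlieBracket_add_right hX hY
  leibniz hf hY := by rw [mlieBracket_smul_right hf hY, add_comm]

omit [FiniteDimensional ℝ E] in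
theorem isDerivationAt_cov (cov : CovariantDerivative I E (TangentSpace I : M → Type _)) (x : M)
    (v : TangentSpace I x) : IsDerivationAt x v (fun Y ↦ cov Y x v) where
  add hX hY := by
    rw [cov.isCovariantDerivativeOnUniv.add hX hY (mem_univ x)]
    rfl
  leibniz hf hY := by
    rw [cov.isCovariantDerivativeOnUniv.leibniz hY hf (mem_univ x)]
    rfl

omit [FiniteDimensional ℝ E] in
theorem SmoothOneFormAt.mdifferentiableAt_apply {α : ∀ y : M, CotangentSpace I y} {x : M}
    (hα : SmoothOneFormAt α x) {Y : ∀ y : M, TangentSpace I y}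
    (hY : MDifferentiableAt I I.tangent (fun y ↦ (⟨y, Y y⟩ : TangentBundle I M)) x) :
    MDifferentiableAt I 𝓘(ℝ) (fun y ↦ α y (Y y)) x := by
  have h1 := hα.mdifferentiableAt (by simp)
  have := MDifferentiableAt.clm_bundle_apply (E₂ := Bundle.Trivial M ℝ) (F₂ := ℝ) h1 hY
  simp only [mdifferentiableAt_totalSpace] at this
  exact this.2

theorem derivOneForm_apply {x : M} {v : TangentSpace I x}
    {D : (∀ y : M, TangentSpace I y) → TangentSpace I x} (hD : IsDerivationAt x v D)
    {α : ∀ y : M, CotangentSpace I y} (hα : SmoothOneFormAt α x)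
    {Y : ∀ y : M, TangentSpace I y}
    (hY : MDifferentiableAt I I.tangent (fun y ↦ (⟨y, Y y⟩ : TangentBundle I M)) x) :
    derivOneForm x v D α (Y x) = mvfderiv I (fun y ↦ α y (Y y)) x v - α x (D Y) := by
  let Φ : (∀ y : M, TangentSpace I y) → ℝ := fun Y ↦ mvfderiv I (fun y ↦ α y (Y y)) x v - α x (D Y)
  have hΦ : TensorialAt I E Φ x := by
    constructor
    · intro f σ hf hσ
      have h1 := hα.mdifferentiableAt_apply hσ
      have h2 : (fun y ↦ α y ((f • σ) y)) = f * fun y ↦ α y (σ y) := by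
        ext y; simp
      simp only [Φ]
      rw [h2, mvfderiv_mul hf h1, hD.leibniz hf hσ]
      simp
      ring
    · intro σ σ' hσ hσ'
      have h1 := hα.mdifferentiableAt_apply hσ
      have h1' := hα.mdifferentiableAt_apply hσ'
      have h2 : (fun y ↦ α y ((σ + σ') y)) = (fun y ↦ α y (σ y)) + fun y ↦ α y (σ' y) := by
        ext y; simp
      simp only [Φ]
      rw [h2, mvfderiv_add h1 h1', hD.add hσ hσ']
      simp
      ring
  have hext : ∀ u : TangentSpace I x, Φ (FiberBundle.extend E u) = TensorialAt.mkHom Φ x hΦ u :=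
    fun u ↦ (TensorialAt.mkHom_apply_eq_extend hΦ u).symm
  have hgoal : Φ Y = TensorialAt.mkHom Φ x hΦ (Y x) := (TensorialAt.mkHom_apply hΦ hY).symm
  change _ = Φ Y
  rw [hgoal]
  have he : derivOneForm x v D α = ∑ j, Φ (FiberBundle.extend E (finBasis ℝ (TangentSpace I x) j))
      • LinearMap.toContinuousLinearMap ((finBasis ℝ (TangentSpace I x)).coord j) := rfl
  rw [he]
  simp only [hext]
  conv_rhs => rw [← (finBasis ℝ (TangentSpace I x)).sum_repr (Y x)]
  rw [map_sum]
  simp only [map_smul, sum_apply, smul_apply, smul_eq_mul,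
    LinearMap.coe_toContinuousLinearMap', Basis.coord_apply]
  exact Finset.sum_congr rfl fun j _ ↦ mul_comm _ _

/-- The derivative of the bivector field `∑ cₖₗ Xₖ ⊗ Xₗ` with constant coefficients. -/
theorem derivBivector_eq_sum {x : M} {v : TangentSpace I x}
    {D : (∀ y : M, TangentSpace I y) → TangentSpace I x} (hD : IsDerivationAt x v D)
    {ι : Type*} [Fintype ι] {X : ι → ∀ y : M, TangentSpace I y} {c : ι → ι → ℝ}
    (hX : ∀ i, MDifferentiableAt I I.tangent (fun y ↦ (⟨y, X i y⟩ : TangentBundle I M)) x)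
    {P : ∀ y : M, TwoTensor I y}
    (hP : ∀ y α β, P y α β = ∑ k, ∑ l, c k l * (α (X k y) * β (X l y)))
    {α β : ∀ y : M, CotangentSpace I y} (hα : SmoothOneFormAt α x) (hβ : SmoothOneFormAt β x) :
    derivBivector x v D P α β =
      ∑ k, ∑ l, c k l * (α x (D (X k)) * β x (X l x) + α x (X k x) * β x (D (X l))) := by
  have ha := fun k ↦ hα.mdifferentiableAt_apply (hX k)
  have hb := fun k ↦ hβ.mdifferentiableAt_apply (hX k)
  have hd : mvfderiv I (fun y ↦ P y (α y) (β y)) x v =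
      ∑ k, ∑ l, c k l * (mvfderiv I (fun y ↦ α y (X k y)) x v * β x (X l x)
        + α x (X k x) * mvfderiv I (fun y ↦ β y (X l y)) x v) := by
    have hc : ∀ k l, MDifferentiableAt I 𝓘(ℝ) (fun _ : M ↦ c k l) x :=
      fun k l ↦ mdifferentiableAt_const
    have hm : ∀ k l, MDifferentiableAt I 𝓘(ℝ) (fun y ↦ c k l * (α y (X k y) * β y (X l y))) x :=
      fun k l ↦ (hc k l).mul ((ha k).mul (hb l))
    simp only [hP]
    rw [mvfderiv_finset_sum _ fun k ↦ mdifferentiableAt_finset_sum _ (hm k)]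
    simp only [mvfderiv_finset_sum _ (hm _), sum_apply]
    refine Finset.sum_congr rfl fun k _ ↦ Finset.sum_congr rfl fun l _ ↦ ?_
    have hab : MDifferentiableAt I 𝓘(ℝ) (fun y ↦ α y (X k y) * β y (X l y)) x :=
      (ha k).mul (hb l)
    rw [mvfderiv_fun_mul (hc k l) hab, mvfderiv_fun_mul (ha k) (hb l), mvfderiv_const]
    simp
    ring
  rw [derivBivector, hd, hP, hP]
  simp only [derivOneForm_apply hD hα (hX _), derivOneForm_apply hD hβ (hX _)]
  simp only [← Finset.sum_sub_distrib]
  refine Finset.sum_congr rfl fun k _ ↦ Finset.sum_congr rfl fun l _ ↦ ?_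
  ring

end Derivation

section Frames

variable {E : Type*} [NormedAddCommGroup E] [NormedSpace ℝ E]
  {H : Type*} [TopologicalSpace H] {I : ModelWithCorners ℝ E H}
  {G : Type*} [TopologicalSpace G] [ChartedSpace H G] [Group G] [LieGroup I ∞ G]

theorem mfderiv_mul_left_inv_apply (x : G) (v : GroupLieAlgebra I G) :
    mfderiv I I (fun y ↦ x⁻¹ * y) x (mulInvariantVectorField v x) = v := by
  have h := mfderiv_comp_apply_of_eq (I' := I) (1 : G)
    (mdifferentiableAt_mul_left (I := I) x⁻¹ x)
    (mdifferentiableAt_mul_left (I := I) x (1 : G)) (mul_one x) v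
  have hid : ((fun y ↦ x⁻¹ * y) ∘ fun y ↦ x * y) = id := by
    ext y; simp
  rw [hid, mfderiv_id] at h
  exact h.symm

theorem mfderiv_mul_right_inv_apply (x : G) (w : GroupLieAlgebra I G) :
    mfderiv I I (fun y ↦ y * x⁻¹) x (rightInvariantField w x) = w := by
  have h := mfderiv_comp_apply_of_eq (I' := I) (1 : G)
    (mdifferentiableAt_mul_right (I := I) x⁻¹ x)
    (mdifferentiableAt_mul_right (I := I) x (1 : G)) (one_mul x) w
  have hid : ((fun y ↦ y * x⁻¹) ∘ fun y ↦ y * x) = id := by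
    ext y; simp
  rw [hid, mfderiv_id] at h
  exact h.symm

variable [FiniteDimensional ℝ E]

/-- Left translation by `x`, as a linear equivalence of the Lie algebra with the tangent space
at `x`. -/
noncomputable def leftTranslationEquiv (x : G) : GroupLieAlgebra I G ≃ₗ[ℝ] TangentSpace I x :=
  LinearEquiv.ofInjectiveOfFinrankEq
    ({ toFun := fun v ↦ mulInvariantVectorField v x
       map_add' := fun v w ↦ congrFun (mulInvariantVectorField_add v w) x
       map_smul' := fun c v ↦ congrFun (mulInvariantVectorField_smul c v) x } :
      GroupLieAlgebra I G →ₗ[ℝ] TangentSpace I x)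
    (LeftInverse.injective (g := fun u ↦ mfderiv I I (fun y ↦ x⁻¹ * y) x u)
      (mfderiv_mul_left_inv_apply x)) rfl

theorem leftTranslationEquiv_apply (x : G) (v : GroupLieAlgebra I G) :
    leftTranslationEquiv x v = mulInvariantVectorField v x := rfl

/-- Right translation by `x`, as a linear equivalence of the Lie algebra with the tangent space
at `x`. -/
noncomputable def rightTranslationEquiv (x : G) : GroupLieAlgebra I G ≃ₗ[ℝ] TangentSpace I x :=
  LinearEquiv.ofInjectiveOfFinrankEq
    ({ toFun := fun v ↦ rightInvariantField v x
       map_add' := fun v w ↦ map_add (mfderiv I I (fun a ↦ a * x) (1 : G)) v w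
       map_smul' := fun c v ↦ map_smul (mfderiv I I (fun a ↦ a * x) (1 : G)) c v } :
      GroupLieAlgebra I G →ₗ[ℝ] TangentSpace I x)
    (LeftInverse.injective (g := fun u ↦ mfderiv I I (fun y ↦ y * x⁻¹) x u)
      (mfderiv_mul_right_inv_apply x)) rfl

theorem rightTranslationEquiv_apply (x : G) (v : GroupLieAlgebra I G) :
    rightTranslationEquiv x v = rightInvariantField v x := rfl

/-- The values of a left-invariant bivector field are determined by its value at the unit. -/
theorem IsLeftInvariant.apply_eq {P : ∀ x : G, TwoTensor I x} (hP : IsLeftInvariant P) (x : G)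
    (α β : CotangentSpace I x) :
    P x α β = valueAtOne P (α.toLinearMap ∘ₗ (leftTranslationEquiv x).toLinearMap)
      (β.toLinearMap ∘ₗ (leftTranslationEquiv x).toLinearMap) := by
  have key : ∀ z (hz : x * 1 = z) (α β : CotangentSpace I z),
      P z α β = P 1 (ContinuousLinearMap.comp (M₂ := TangentSpace I (x * 1)) α
        (mfderiv I I (fun y ↦ x * y) 1)) (ContinuousLinearMap.comp (M₂ := TangentSpace I (x * 1)) β
        (mfderiv I I (fun y ↦ x * y) 1)) := by
    rintro z rfl α β
    exact hP x 1 α β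
  exact key x (mul_one x) α β

/-- A left-invariant bivector field in a left-invariant frame. -/
theorem IsLeftInvariant.apply_eq_sum {P : ∀ x : G, TwoTensor I x} (hP : IsLeftInvariant P)
    {ι : Type*} [Fintype ι] (b : Basis ι ℝ (GroupLieAlgebra I G)) (x : G)
    (α β : CotangentSpace I x) :
    P x α β = ∑ k, ∑ l, valueAtOne P (b.coord k) (b.coord l) *
      (α (mulInvariantVectorField (b k) x) * β (mulInvariantVectorField (b l) x)) := by
  rw [hP.apply_eq, ← sum_coord_mul_apply b]
  rfl

variable [RiemannianBundle (fun x : G ↦ TangentSpace I x)]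

omit [LieGroup I ∞ G] [FiniteDimensional ℝ E] in
/-- The inner products of right-invariant vector fields with respect to a right-invariant metric
are constant. -/
theorem IsRightInvariantMetric.inner_rightInvariantField (hg : IsRightInvariantMetric I G)
    (v w : TangentSpace I (1 : G)) (x : G) :
    inner ℝ (rightInvariantField (I := I) v x) (rightInvariantField (I := I) w x) = inner ℝ v w := by
  have key : ∀ z, 1 * x = z → ∀ v' w' : E,
      inner (E := TangentSpace I z) ℝ v' w' = inner (E := TangentSpace I (1 * x)) ℝ v' w' := by
    rintro z rfl v' w'
    rfl
  exact (key x (one_mul x) _ _).trans (hg x 1 v w)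

/-- Right translation by `x`, as an isometry for a right-invariant metric. -/
noncomputable def IsRightInvariantMetric.rightTranslationIsometry
    (hg : IsRightInvariantMetric I G) (x : G) : TangentSpace I (1 : G) ≃ₗᵢ[ℝ] TangentSpace I x :=
  (rightTranslationEquiv (I := I) x).isometryOfInner
    fun v w ↦ hg.inner_rightInvariantField v w x

/-- A right-invariant orthonormal frame. -/
noncomputable def IsRightInvariantMetric.frame (hg : IsRightInvariantMetric I G) (x : G) :
    OrthonormalBasis (Fin (finrank ℝ (TangentSpace I (1 : G)))) ℝ (TangentSpace I x) :=
  (stdOrthonormalBasis ℝ (TangentSpace I (1 : G))).map (hg.rightTranslationIsometry x)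

theorem IsRightInvariantMetric.frame_apply (hg : IsRightInvariantMetric I G) (x : G)
    (i : Fin (finrank ℝ (TangentSpace I (1 : G)))) :
    hg.frame x i =
      rightInvariantField (I := I) (stdOrthonormalBasis ℝ (TangentSpace I (1 : G)) i) x := by
  simp only [frame, OrthonormalBasis.map_apply]
  rfl

theorem IsRightInvariantMetric.mdifferentiableAt_frame (hg : IsRightInvariantMetric I G) (x : G)
    (i : Fin (finrank ℝ (TangentSpace I (1 : G)))) :
    MDifferentiableAt I I.tangent (fun y ↦ (⟨y, hg.frame y i⟩ : TangentBundle I G)) x := by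
  simp only [hg.frame_apply]
  exact mdifferentiableAt_rightInvariantField _ x

end Frames

section Divergence

variable {E : Type*} [NormedAddCommGroup E] [NormedSpace ℝ E] [FiniteDimensional ℝ E]
  {H : Type*} [TopologicalSpace H] {I : ModelWithCorners ℝ E H} [I.Boundaryless]
  {G : Type*} [TopologicalSpace G] [ChartedSpace H G] [Group G] [LieGroup I ∞ G]
  [RiemannianBundle (fun x : G ↦ TangentSpace I x)]
  [IsContMDiffRiemannianBundle I ∞ E (fun x : G ↦ TangentSpace I x)]

/-- Left-invariant vector fields are Killing fields of right-invariant metrics. -/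
theorem IsLeviCivita.inner_mulInvariantVectorField_self
    {cov : CovariantDerivative I E (TangentSpace I : G → Type _)} (hcov : IsLeviCivita cov)
    (hg : IsRightInvariantMetric I G) (u : GroupLieAlgebra I G) (x : G) (v : TangentSpace I x) :
    inner ℝ (cov (mulInvariantVectorField u) x v) v = 0 := by
  obtain ⟨w, rfl⟩ := (rightTranslationEquiv x).surjective v
  rw [rightTranslationEquiv_apply]
  have hR := mdifferentiableAt_rightInvariantField (I := I) w x
  have hX := mdifferentiableAt_mulInvariantVectorField (I := I) u (g := x)
  have h1 := hcov.metric x (mulInvariantVectorField u x) _ _ hR hR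
  simp only [hg.inner_rightInvariantField] at h1
  rw [mvfderiv_const, real_inner_comm, ← two_mul] at h1
  have h2 := cov.torsion_apply hX hR
  rw [hcov.torsion_eq_zero, mlieBracket_mulInvariant_rightInvariant, sub_zero] at h2
  rw [← sub_eq_zero.1 h2.symm, real_inner_comm]
  simpa using h1.symm

/-- Left-invariant vector fields are divergence free for right-invariant metrics. -/
theorem IsLeviCivita.trace_mulInvariantVectorField
    {cov : CovariantDerivative I E (TangentSpace I : G → Type _)} (hcov : IsLeviCivita cov)
    (hg : IsRightInvariantMetric I G) (u : GroupLieAlgebra I G) (x : G) :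
    LinearMap.trace ℝ (TangentSpace I x) (cov (mulInvariantVectorField u) x).toLinearMap = 0 := by
  rw [LinearMap.trace_eq_sum_inner _ (stdOrthonormalBasis ℝ (TangentSpace I x))]
  refine Finset.sum_eq_zero fun i _ ↦ ?_
  rw [real_inner_comm]
  exact hcov.inner_mulInvariantVectorField_self hg u x _

omit [FiniteDimensional ℝ E] [I.Boundaryless] [RiemannianBundle (fun x : G ↦ TangentSpace I x)]
  [IsContMDiffRiemannianBundle I ∞ E (fun x : G ↦ TangentSpace I x)] in
theorem smoothOneFormAt_extend {x : G} (α : CotangentSpace I x) :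
    SmoothOneFormAt (fun y ↦ FiberBundle.extend (E →L[ℝ] ℝ)
      (E := fun y : G ↦ CotangentSpace I y) α y) x :=
  FiberBundle.contMDiffAt_extend I (E →L[ℝ] ℝ) α

theorem divBivector_eq_zero (hg : IsRightInvariantMetric I G) {P : ∀ x : G, TwoTensor I x}
    (hP : IsUnimodularLeftInvariantPoisson P)
    {cov : CovariantDerivative I E (TangentSpace I : G → Type _)} (hcov : IsLeviCivita cov)
    {β : ∀ y : G, CotangentSpace I y} {x : G} (hβ : SmoothOneFormAt β x) :
    divBivector cov P β x = 0 := by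
  obtain ⟨-, hleft, hyb⟩ := hP
  let b := finBasis ℝ (GroupLieAlgebra I G)
  let X := fun k ↦ mulInvariantVectorField (I := I) (G := G) (b k)
  let c := fun k l ↦ valueAtOne P (b.coord k) (b.coord l)
  have hX : ∀ k, MDifferentiableAt I I.tangent (fun y ↦ (⟨y, X k y⟩ : TangentBundle I G)) x :=
    fun k ↦ mdifferentiableAt_mulInvariantVectorField (b k)
  let e := finBasis ℝ (TangentSpace I x)
  have h1 : ∀ i, covDerivBivector cov P
      (fun y ↦ FiberBundle.extend (E →L[ℝ] ℝ) (E := fun y : G ↦ CotangentSpace I y) (x := x)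
        (LinearMap.toContinuousLinearMap (e.coord i)) y) β x (e i) =
      ∑ k, ∑ l, c k l * (e.coord i (cov (X k) x (e i)) * β x (X l x)
        + e.coord i (X k x) * β x (cov (X l) x (e i))) := by
    intro i
    rw [covDerivBivector, derivBivector_eq_sum (isDerivationAt_cov cov x (e i)) hX
      (hleft.apply_eq_sum b) (smoothOneFormAt_extend _) hβ]
    simp only [FiberBundle.extend_apply_self, LinearMap.coe_toContinuousLinearMap']
    rfl
  have h2 : ∀ k, ∑ i, e.coord i (cov (X k) x (e i)) = 0 := by
    intro k
    have := hcov.trace_mulInvariantVectorField hg (b k) x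
    rw [LinearMap.trace_eq_matrix_trace ℝ e, Matrix.trace] at this
    simp only [Matrix.diag_apply, LinearMap.toMatrix_apply] at this
    exact this
  have h3 : ∀ k l, ∑ i, e.coord i (X k x) * β x (cov (X l) x (e i)) = β x (cov (X l) x (X k x)) := by
    intro k l
    have := congrArg (fun v ↦ β x (cov (X l) x v)) (e.sum_repr (X k x))
    simp only [map_sum, map_smul, smul_eq_mul] at this
    exact this
  have h4 : divBivector cov P β x = ∑ k, ∑ l, c k l * β x (cov (X l) x (X k x)) := by
    refine (Finset.sum_congr rfl fun i _ ↦ h1 i).trans ?_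
    rw [Finset.sum_comm]
    refine Finset.sum_congr rfl fun k _ ↦ ?_
    rw [Finset.sum_comm]
    refine Finset.sum_congr rfl fun l _ ↦ ?_
    rw [← Finset.mul_sum, Finset.sum_add_distrib, ← Finset.sum_mul, h2, h3, zero_mul, zero_add]
  have h5 : ∀ k l, cov (X l) x (X k x) - cov (X k) x (X l x) =
      mulInvariantVectorField ⁅b k, b l⁆ x := by
    intro k l
    have := cov.torsion_apply (hX k) (hX l)
    rw [hcov.torsion_eq_zero] at this
    rw [← mlieBracket_mulInvariantVectorField]
    exact sub_eq_zero.1 this.symm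
  have hskew : ∀ k l, c k l = - c l k := by
    obtain ⟨hr, -⟩ := hyb
    exact fun k l ↦ hr.skew _ _
  have h6 : ∑ k, ∑ l, c k l * β x (cov (X l) x (X k x)) =
      - ∑ k, ∑ l, c k l * β x (cov (X k) x (X l x)) := by
    rw [Finset.sum_comm, ← Finset.sum_neg_distrib]
    refine Finset.sum_congr rfl fun k _ ↦ ?_
    rw [← Finset.sum_neg_distrib]
    refine Finset.sum_congr rfl fun l _ ↦ ?_
    rw [hskew l k, neg_mul]
  have h7 : ∑ k, ∑ l, c k l * β x (cov (X l) x (X k x)) -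
      ∑ k, ∑ l, c k l * β x (cov (X k) x (X l x)) = 0 := by
    have := congrArg (fun v ↦ β x (leftTranslationEquiv x v)) (hyb.sum_smul_lie_eq_zero b)
    simp only [map_sum, map_smul, map_zero, leftTranslationEquiv_apply, ← h5, map_sub,
      smul_eq_mul, mul_sub, Finset.sum_sub_distrib] at this
    exact this
  rw [h4]
  linarith

end Divergence

section Casimir

variable {E : Type*} [NormedAddCommGroup E] [NormedSpace ℝ E] [FiniteDimensional ℝ E]
  {H : Type*} [TopologicalSpace H] {I : ModelWithCorners ℝ E H} [I.Boundaryless]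
  {G : Type*} [TopologicalSpace G] [ChartedSpace H G] [Group G] [LieGroup I ∞ G]
  [RiemannianBundle (fun x : G ↦ TangentSpace I x)]

omit [I.Boundaryless] in
theorem IsRightInvariantMetric.gradient_eq_sum (hg : IsRightInvariantMetric I G) (f : G → ℝ) :
    gradient (I := I) f = fun y ↦ ∑ i, mvfderiv I f y (hg.frame y i) • hg.frame y i := by
  ext1 y
  rw [← (hg.frame y).sum_repr' (gradient f y)]
  refine Finset.sum_congr rfl fun i _ ↦ ?_
  rw [real_inner_comm, inner_gradient]

/-- The gradient of a function which is constant along a left-invariant vector field commutes with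
this field. -/
theorem IsRightInvariantMetric.mlieBracket_gradient_eq_zero (hg : IsRightInvariantMetric I G)
    {f : G → ℝ} {x : G} (hf : ContMDiffAt I 𝓘(ℝ) 2 f x) {u : GroupLieAlgebra I G}
    (hu : ∀ᶠ y in 𝓝 x, mvfderiv I f y (mulInvariantVectorField u y) = 0) :
    mlieBracket I (gradient f) (mulInvariantVectorField u) x = 0 := by
  have : IsManifold I 2 G := .of_le (n := ∞) (by simpa using ENat.LEInfty.out)
  rw [mlieBracket_swap_apply, neg_eq_zero, hg.gradient_eq_sum f]
  have hR := hg.mdifferentiableAt_frame x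
  rw [(isDerivationAt_mlieBracket (mulInvariantVectorField u) x).sum_smul Finset.univ
    (fun i ↦ mdifferentiableAt_mvfderiv_apply hf (hR i)) hR]
  refine Finset.sum_eq_zero fun i _ ↦ ?_
  simp only [hg.frame_apply]
  rw [mlieBracket_mulInvariant_rightInvariant, ← mvfderiv_mulInvariant_rightInvariant_comm hf,
    mvfderiv_congr (show (fun y ↦ mvfderiv I f y (mulInvariantVectorField u y)) =ᶠ[𝓝 x]
      fun _ ↦ 0 from hu), mvfderiv_const]
  simp

theorem lieDerivBivector_gradient_eq_zero (hg : IsRightInvariantMetric I G)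
    {P : ∀ x : G, TwoTensor I x} (hP : IsLeftInvariant P)
    (hr : IsYangBaxterSolution (valueAtOne P))
    {f : G → ℝ} {x : G} (hf : ContMDiffAt I 𝓘(ℝ) 2 f x)
    (hcas : ∀ᶠ y in 𝓝 x, P y (mvfderiv I f y) = 0)
    {α β : ∀ y : G, CotangentSpace I y} (hα : SmoothOneFormAt α x) (hβ : SmoothOneFormAt β x) :
    lieDerivBivector (gradient f) P α β x = 0 := by
  let b := finBasis ℝ (GroupLieAlgebra I G)
  have hX := fun v : GroupLieAlgebra I G ↦ mdifferentiableAt_mulInvariantVectorField v (g := x)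
  have hD := isDerivationAt_mlieBracket (gradient (I := I) f) x
  let D : GroupLieAlgebra I G →ₗ[ℝ] TangentSpace I x :=
    { toFun := fun u ↦ mlieBracket I (gradient f) (mulInvariantVectorField u) x
      map_add' := fun u w ↦ by
        rw [mulInvariantVectorField_add]
        exact mlieBracket_add_right (hX u) (hX w)
      map_smul' := fun c u ↦ by
        rw [mulInvariantVectorField_smul]
        exact mlieBracket_const_smul_right (hX u) }
  have hzero : ∀ φ : Dual ℝ (GroupLieAlgebra I G), D (sharp (valueAtOne P) φ) = 0 := by
    intro φ
    refine hg.mlieBracket_gradient_eq_zero hf ?_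
    filter_upwards [hcas] with y hy
    have h1 := hP.apply_eq y (mvfderiv I f y)
      (LinearMap.toContinuousLinearMap (φ ∘ₗ (leftTranslationEquiv y).symm.toLinearMap))
    rw [hy] at h1
    have h2 : ((LinearMap.toContinuousLinearMap
        (φ ∘ₗ (leftTranslationEquiv y).symm.toLinearMap)).toLinearMap ∘ₗ
        (leftTranslationEquiv y).toLinearMap) = φ := by
      ext u
      simp
    rw [h2, ← apply_sharp] at h1
    exact h1.symm
  rw [lieDerivBivector, derivBivector_eq_sum hD (fun k ↦ hX (b k)) (hP.apply_eq_sum b) hα hβ]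
  simp only [mul_add, Finset.sum_add_distrib]
  have h1 := sum_coord_mul_apply b (valueAtOne P) ((α x).toLinearMap ∘ₗ D)
    ((β x).toLinearMap ∘ₗ (leftTranslationEquiv x).toLinearMap)
  have h2 := sum_coord_mul_apply b (valueAtOne P)
    ((α x).toLinearMap ∘ₗ (leftTranslationEquiv x).toLinearMap) ((β x).toLinearMap ∘ₗ D)
  rw [← apply_sharp, LinearMap.comp_apply, hzero, map_zero] at h1
  rw [hr.skew, ← apply_sharp, LinearMap.comp_apply, hzero, map_zero, neg_zero] at h2
  exact (congrArg₂ (· + ·) h1 h2).trans (add_zero 0)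

end Casimir

section LeviCivita

variable {E : Type*} [NormedAddCommGroup E] [NormedSpace ℝ E] [FiniteDimensional ℝ E]
  {H : Type*} [TopologicalSpace H] {I : ModelWithCorners ℝ E H}
  {M : Type*} [TopologicalSpace M] [ChartedSpace H M] [IsManifold I ∞ M]
  [RiemannianBundle (fun x : M ↦ TangentSpace I x)]
  {ι : Type*} [Fintype ι] (e : ∀ x : M, OrthonormalBasis ι ℝ (TangentSpace I x))

/-- The structure functions `⟪[eᵢ, eⱼ], eₖ⟫` of an orthonormal frame. -/
noncomputable def structureFunction (i j k : ι) (x : M) : ℝ :=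
  inner ℝ (mlieBracket I (fun y ↦ e y i) (fun y ↦ e y j) x) (e x k)

/-- The Christoffel symbols `⟪∇ eⱼ eᵢ, eₖ⟫` of an orthonormal frame, from the Koszul formula. -/
noncomputable def christoffel (i j k : ι) (x : M) : ℝ :=
  (structureFunction e i j k x - structureFunction e j k i x + structureFunction e k i j x) / 2

omit [FiniteDimensional ℝ E] [IsManifold I ∞ M] in
theorem structureFunction_swap (i j k : ι) (x : M) :
    structureFunction e i j k x = - structureFunction e j i k x := by
  rw [structureFunction, mlieBracket_swap_apply, inner_neg_left, structureFunction]

omit [FiniteDimensional ℝ E] [IsManifold I ∞ M] in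
theorem christoffel_swap_right (i j k : ι) (x : M) :
    christoffel e i j k x = - christoffel e i k j x := by
  rw [christoffel, christoffel, structureFunction_swap e i k j, structureFunction_swap e k j i,
    structureFunction_swap e j i k]
  ring

omit [FiniteDimensional ℝ E] [IsManifold I ∞ M] in
theorem christoffel_sub_christoffel (i j k : ι) (x : M) :
    christoffel e i j k x - christoffel e j i k x = structureFunction e i j k x := by
  rw [christoffel, christoffel, structureFunction_swap e j i k, structureFunction_swap e i k j,
    structureFunction_swap e k j i]
  ring

/-- The component of `∇ Y` along `eₖ`, as a 1-form. -/
noncomputable def frameCovComponent (k : ι) (Y : ∀ y : M, TangentSpace I y) (x : M) :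
    TangentSpace I x →L[ℝ] ℝ :=
  mvfderiv I (fun y ↦ inner ℝ (Y y) (e y k)) x +
    LinearMap.toContinuousLinearMap (∑ i, (∑ j, inner ℝ (Y x) (e x j) * christoffel e i j k x) •
      (e x).toBasis.coord i)

omit [IsManifold I ∞ M] in
theorem frameCovComponent_apply (k : ι) (Y : ∀ y : M, TangentSpace I y) (x : M)
    (v : TangentSpace I x) :
    frameCovComponent e k Y x v = mvfderiv I (fun y ↦ inner ℝ (Y y) (e y k)) x v +
      ∑ i, ∑ j, inner ℝ (Y x) (e x j) * christoffel e i j k x * inner ℝ (e x i) v := by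
  simp [frameCovComponent, Finset.sum_mul, OrthonormalBasis.repr_apply_apply]

variable [IsContMDiffRiemannianBundle I ∞ E (fun x : M ↦ TangentSpace I x)]
  (he : ∀ x i, MDifferentiableAt I I.tangent (fun y ↦ (⟨y, e y i⟩ : TangentBundle I M)) x)

include he in
omit [FiniteDimensional ℝ E] in
theorem mdifferentiableAt_inner_frame {Y : ∀ y : M, TangentSpace I y} {x : M}
    (hY : MDifferentiableAt I I.tangent (fun y ↦ (⟨y, Y y⟩ : TangentBundle I M)) x) (k : ι) :
    MDifferentiableAt I 𝓘(ℝ) (fun y ↦ inner ℝ (Y y) (e y k)) x :=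
  MDifferentiableAt.inner_bundle hY (he x k)

/-- The Levi-Civita connection in terms of a differentiable orthonormal frame. -/
noncomputable def frameCov : CovariantDerivative I E (TangentSpace I : M → Type _) where
  toFun Y x := ∑ k, (frameCovComponent e k Y x).smulRight (e x k)
  isCovariantDerivativeOnUniv :=
    { add := by
        intro Y Y' x hY hY' _
        rw [← Finset.sum_add_distrib]
        refine Finset.sum_congr rfl fun k _ ↦ ?_
        ext v
        simp only [ContinuousLinearMap.smulRight_apply, add_apply, ← add_smul,
          frameCovComponent_apply, Pi.add_apply, inner_add_left]
        rw [mvfderiv_fun_add (mdifferentiableAt_inner_frame e he hY k)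
          (mdifferentiableAt_inner_frame e he hY' k)]
        simp only [add_apply, add_mul, Finset.sum_add_distrib]
        congr 1
        ring
      leibniz := by
        intro Y g x hY hg _
        ext v
        simp only [add_apply, smul_apply, sum_apply, ContinuousLinearMap.smulRight_apply,
          frameCovComponent_apply, Pi.smul_apply', real_inner_smul_left]
        have hd : ∀ k, mvfderiv I (fun y ↦ g y * inner ℝ (Y y) (e y k)) x =
            g x • mvfderiv I (fun y ↦ inner ℝ (Y y) (e y k)) x +
              inner ℝ (Y x) (e x k) • mvfderiv I g x :=
          fun k ↦ mvfderiv_fun_mul hg (mdifferentiableAt_inner_frame e he hY k)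
        have hYx : mvfderiv I g x v • Y x =
            ∑ k, (mvfderiv I g x v * inner ℝ (Y x) (e x k)) • e x k := by
          simp only [mul_smul, ← Finset.smul_sum, real_inner_comm (e x _)]
          rw [(e x).sum_repr' (Y x)]
        simp only [hd]
        rw [hYx, Finset.smul_sum, ← Finset.sum_add_distrib]
        refine Finset.sum_congr rfl fun k _ ↦ ?_
        rw [smul_smul, ← add_smul]
        congr 1
        simp only [mul_assoc, ← Finset.mul_sum, add_apply, smul_apply, smul_eq_mul]
        ring }

theorem inner_frameCov (Y : ∀ y : M, TangentSpace I y) (x : M) (v w : TangentSpace I x) :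
    inner ℝ (frameCov e he Y x v) w = ∑ k, frameCovComponent e k Y x v * inner ℝ (e x k) w := by
  change inner ℝ ((∑ k, (frameCovComponent e k Y x).smulRight (e x k)) v) w = _
  simp [sum_inner, real_inner_smul_left]

theorem isLeviCivita_frameCov : IsLeviCivita (frameCov e he) := by
  classical
  have horth : ∀ i k, (fun y ↦ inner ℝ (e y i) (e y k)) = fun _ : M ↦ if i = k then (1 : ℝ) else 0 :=
    fun i k ↦ funext fun y ↦ orthonormal_iff_ite.1 (e y).orthonormal i k
  constructor
  · ext1 x
    have hcomp : ∀ i j k, inner ℝ (frameCov e he (fun y ↦ e y j) x (e x i)) (e x k) =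
        christoffel e i j k x := by
      intro i j k
      rw [inner_frameCov]
      simp only [frameCovComponent_apply, horth, mvfderiv_const]
      simp [orthonormal_iff_ite.1 (e x).orthonormal]
    have h0 : ∀ i j, (frameCov e he).torsion x (e x i) (e x j) = 0 := by
      intro i j
      have h := (frameCov e he).torsion_apply (he x i) (he x j)
      rw [h]
      refine InnerProductSpace.ext_inner_right_basis (e x).toBasis fun k ↦ ?_
      rw [OrthonormalBasis.coe_toBasis, inner_sub_left, inner_sub_left, hcomp, hcomp,
        christoffel_sub_christoffel, structureFunction, sub_self, inner_zero_left]
    have h1 : ((frameCov e he).torsion x).toLinearMap = 0 := by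
      refine (e x).toBasis.ext fun i ↦ ?_
      ext w
      have h2 : ((frameCov e he).torsion x (e x i)).toLinearMap = 0 :=
        (e x).toBasis.ext fun j ↦ by simpa using h0 i j
      simpa using LinearMap.congr_fun h2 w
    ext u w
    exact DFunLike.congr_fun (LinearMap.congr_fun h1 u) w
  · intro x v X Y hX hY
    have hXk := mdifferentiableAt_inner_frame e he hX
    have hYk := mdifferentiableAt_inner_frame e he hY
    have hsum : (fun y ↦ inner ℝ (X y) (Y y)) =
        fun y ↦ ∑ k, inner ℝ (X y) (e y k) * inner ℝ (Y y) (e y k) := by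
      ext y
      rw [← (e y).sum_inner_mul_inner (X y) (Y y)]
      simp only [real_inner_comm]
    have hswap : ∑ k, (∑ i, ∑ j, inner ℝ (X x) (e x j) * christoffel e i j k x *
          inner ℝ (e x i) v) * inner ℝ (Y x) (e x k) =
        - ∑ k, (∑ i, ∑ j, inner ℝ (Y x) (e x j) * christoffel e i j k x *
          inner ℝ (e x i) v) * inner ℝ (X x) (e x k) := by
      have hc : ∀ a b : ι → ℝ, ∑ k, (∑ i, ∑ j, a j * christoffel e i j k x *
          inner ℝ (e x i) v) * b k =
          ∑ i, ∑ k, ∑ j, a j * christoffel e i j k x * inner ℝ (e x i) v * b k := by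
        intro a b
        rw [Finset.sum_comm]
        simp only [Finset.sum_mul]
      rw [hc, hc, ← Finset.sum_neg_distrib]
      refine Finset.sum_congr rfl fun i _ ↦ ?_
      rw [Finset.sum_comm, ← Finset.sum_neg_distrib]
      refine Finset.sum_congr rfl fun j _ ↦ ?_
      rw [← Finset.sum_neg_distrib]
      refine Finset.sum_congr rfl fun k _ ↦ ?_
      rw [christoffel_swap_right e i j k]
      ring
    have hm : ∀ k, MDifferentiableAt I 𝓘(ℝ)
        (fun y ↦ inner ℝ (X y) (e y k) * inner ℝ (Y y) (e y k)) x := fun k ↦ (hXk k).mul (hYk k)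
    rw [hsum, mvfderiv_finset_sum _ hm, real_inner_comm _ (X x),
      inner_frameCov, inner_frameCov]
    simp only [frameCovComponent_apply, add_mul, Finset.sum_add_distrib]
    simp only [real_inner_comm (Y x), real_inner_comm (X x)]
    rw [hswap]
    simp only [sum_apply, mvfderiv_fun_mul (hXk _) (hYk _), add_apply, smul_apply, smul_eq_mul,
      Finset.sum_add_distrib]
    simp only [mul_comm]
    ring

end LeviCivita

end KillingPoisson

theorem corollary1p1
    {E : Type*} [NormedAddCommGroup E] [NormedSpace ℝ E] [FiniteDimensional ℝ E]
    {H : Type*} [TopologicalSpace H] {I : ModelWithCorners ℝ E H} [I.Boundaryless]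
    {G : Type*} [TopologicalSpace G] [ChartedSpace H G] [Group G] [LieGroup I ∞ G]
    [RiemannianBundle (fun x : G ↦ TangentSpace I x)]
    [IsContMDiffRiemannianBundle I ∞ E (fun x : G ↦ TangentSpace I x)]
    (hg : KillingPoisson.IsRightInvariantMetric I G)
    (P : ∀ x : G, KillingPoisson.TwoTensor I x)
    (hP : KillingPoisson.IsUnimodularLeftInvariantPoisson P) :
    KillingPoisson.IsKillingPoissonTensor P := by
  refine ⟨hP.1, ?_, ?_, ?_⟩
  · exact ⟨KillingPoisson.frameCov hg.frame hg.mdifferentiableAt_frame,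
      KillingPoisson.isLeviCivita_frameCov _ _⟩
  · intro cov hcov x β hβ
    exact KillingPoisson.divBivector_eq_zero hg hP hcov hβ
  · intro U f hU hf hcas x hx α β hα hβ
    obtain ⟨-, hleft, hr, -⟩ := hP
    refine KillingPoisson.lieDerivBivector_gradient_eq_zero hg hleft hr
      ((hf.contMDiffAt (hU.mem_nhds hx)).of_le (by simpa using ENat.LEInfty.out)) ?_ hα hβ
    filter_upwards [hU.mem_nhds hx] with y hy using hcas y hy
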